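/- **Theorem 3.3 (Classification of Heisenberg vectors).** Let $V=\mathbb{C}[x_1,x_2,\dots]$ be the Fock representation of charge $0$ of the Heisenberg algebra, on which $\alpha_n$ acts as $n\,\partial/\partial x_n$ for $n>0$, as $0$ for $n=0$, and as multiplication by $x_{-n}$ for $n<0$. Put $\alpha(z)=\sum_{n\in\mathbb{Z}}\alpha_n z^{-n-1}$, and equip $V$ with the free bosonic vertex algebra structure, i.e. the unique vertex algebra structure over $\mathbb{C}$ with vacuum vector $1$ and $Y(x_1,z)=\alpha(z)$. An element $h\in V$ is called a (normalized) Heisenberg vector if the Fourier modes of $Y(h,z)=\sum_{n\in\mathbb{Z}}h_{(n)}z^{-n-1}$ satisfy $[h_{(m)},h_{(n)}]=m\,\delta_{m+n,0}\operatorname{id}_V$ for all $m,n\in\mathbb{Z}$ (equivalently, $h_{(1)}h=1$ and $h_{(n)}h=0$ for $n=0$ and all $n\ge 2$). Then $h\in V$ is a Heisenberg vector if and only if $h=\mu+x_1$ or $h=\mu-x_1$ for some $\mu\in\mathbb{C}$. Moreover, for each $\mu\in\mathbb{C}$ and each choice of sign, $h=\mu\pm x_1$ if and only if $Y(h,z)=\mu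 I(z)\pm\alpha(z)$, where $I(z)=\operatorname{id}_V$ is the identity field. -/

import Mathlib

noncomputable section

open VertexOperator

/-- A vertex algebra over `ℂ`, by Borcherds' axioms.  The products are `a_(n) b = ncoeff (Y a) n b`.
That `Y a` is a `VertexOperator` (a linear map from `V` to Laurent series with coefficients in `V`)
says that for all `a`, `b` one has `a_(n) b = 0` for all large `n`; in particular all the sums in
the Borcherds identity have finitely many nonzero terms. -/
structure VertexAlgebra (V : Type*) [AddCommGroup V] [Module ℂ V] where
  /-- the vacuum vector -/
  vacuum : V
  /-- the state-field correspondence `a ↦ Y(a,z) = ∑ a_(n) z^(-n-1)` -/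
  Y : V →ₗ[ℂ] VertexOperator ℂ V
  /-- the Borcherds identity -/
  borcherds : ∀ (a b c : V) (k l m : ℤ),
    ∑ᶠ i : ℕ, Ring.choose k i • ncoeff (Y (ncoeff (Y a) (m + i) b)) (k + l - i) c =
      ∑ᶠ i : ℕ, ((-1) ^ i * Ring.choose m i) •
        (ncoeff (Y a) (k + m - i) (ncoeff (Y b) (l + i) c) -
          (m.negOnePow : ℤ) • ncoeff (Y b) (l + m - i) (ncoeff (Y a) (k + i) c))
  vacuum_nonneg : ∀ (a : V) (n : ℤ), 0 ≤ n → ncoeff (Y a) n vacuum = 0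
  vacuum_neg_one : ∀ a : V, ncoeff (Y a) (-1) vacuum = a

namespace FormalField

variable {M : Type*} [AddCommGroup M] [Module ℂ M]

theorem eventually_zero (A : VertexOperator ℂ M) (v : M) :
    ∃ N : ℕ, ∀ n : ℤ, (N : ℤ) ≤ n → (A[[n]]) v = 0 := by
  refine ⟨(1 - HahnSeries.order ((HahnModule.of ℂ).symm (A v))).toNat, fun n hn => ?_⟩
  apply VertexOperator.ncoeff_eq_zero_of_lt_order
  have := Int.self_le_toNat (1 - HahnSeries.order ((HahnModule.of ℂ).symm (A v)))
  omega

/-- The field `∑ f n z^(-n-1)` with given Fourier modes `f n`. -/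
def ofModes (f : ℤ → Module.End ℂ M) (hf : ∀ v, ∃ N : ℤ, ∀ n, N ≤ n → f n v = 0) :
    VertexOperator ℂ M :=
  VertexOperator.of_coeff (fun n => f (-n - 1)) (by
    intro v
    obtain ⟨N, hN⟩ := hf v
    refine ⟨-N - 1, fun n hn => ?_⟩
    by_contra h
    exact hn (hN _ (by omega)))

@[simp]
theorem ofModes_ncoeff (f : ℤ → Module.End ℂ M) (hf) (n : ℤ) : ((ofModes f hf)[[n]]) = f n := by
  simp [ofModes]

theorem ext_modes {A B : VertexOperator ℂ M} (h : ∀ n, (A[[n]]) = (B[[n]])) : A = B := by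
  apply HVertexOperator.coeff_inj
  funext n
  simpa using h (-n - 1)

theorem finsum_nat {X : Type*} [AddCommGroup X] (f : ℕ → X) (N : ℕ) (h : ∀ i, N ≤ i → f i = 0) :
    ∑ᶠ i, f i = ∑ i ∈ Finset.range N, f i := by
  apply finsum_eq_sum_of_support_subset
  intro i hi
  by_contra h'
  exact hi (h i (by simpa using h'))

/-- The operator `∑ i, (-1)^i (m choose i) A_(k+m-i) B_(l+i)`, a Fourier mode of the product of
`A(y) B(z)` with the expansion of `(y-z)^m` in the region `|y| > |z|`. -/
def half (A B : VertexOperator ℂ M) (k l m : ℤ) : Module.End ℂ M where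
  toFun v := ∑ᶠ i : ℕ, ((-1) ^ i * Ring.choose m i) • (A[[k + m - i]]) ((B[[l + i]]) v)
  map_add' u v := by
    obtain ⟨N, hN⟩ := eventually_zero B u
    obtain ⟨N', hN'⟩ := eventually_zero B v
    rw [finsum_nat _ (N + N' + l.natAbs), finsum_nat _ (N + N' + l.natAbs),
      finsum_nat _ (N + N' + l.natAbs), ← Finset.sum_add_distrib]
    · simp
    · intro i hi; rw [hN' _ (by omega)]; simp
    · intro i hi; rw [hN _ (by omega)]; simp
    · intro i hi; rw [map_add, hN _ (by omega), hN' _ (by omega)]; simp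
  map_smul' c v := by
    obtain ⟨N, hN⟩ := eventually_zero B v
    rw [finsum_nat _ (N + l.natAbs), finsum_nat _ (N + l.natAbs), Finset.smul_sum]
    · simp [smul_comm c]
    · intro i hi; rw [hN _ (by omega)]; simp
    · intro i hi; rw [map_smul, hN _ (by omega)]; simp

theorem half_apply (A B : VertexOperator ℂ M) (k l m : ℤ) (v : M) :
    half A B k l m v =
      ∑ᶠ i : ℕ, ((-1) ^ i * Ring.choose m i) • (A[[k + m - i]]) ((B[[l + i]]) v) := rfl

theorem half_apply_sum (A B : VertexOperator ℂ M) (k l m : ℤ) (v : M) (N : ℕ)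
    (hN : ∀ n : ℤ, N + l ≤ n → (B[[n]]) v = 0) :
    half A B k l m v =
      ∑ i ∈ Finset.range N, ((-1) ^ i * Ring.choose m i) • (A[[k + m - i]]) ((B[[l + i]]) v) := by
  rw [half_apply, finsum_nat _ N]
  intro i hi; rw [hN _ (by omega)]; simp

/-- The modes of `(y-z)^m` times `A(y) B(z)`, respectively `B(z) A(y)`, with `(y-z)^m` expanded in
`|y| > |z|`, respectively in `|y| < |z|`, and with the difference taken. -/
def bracket (A B : VertexOperator ℂ M) (k l m : ℤ) : Module.End ℂ M :=
  half A B k l m - (m.negOnePow : ℤ) • half B A l k m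

theorem half_zero_right (A B : VertexOperator ℂ M) (k l : ℤ) :
    half A B k l 0 = (A[[k]]) * (B[[l]]) := by
  ext v
  rw [half_apply, finsum_nat _ 1]
  · simp
  · intro i hi
    obtain ⟨j, rfl⟩ : ∃ j, i = j + 1 := ⟨i - 1, by omega⟩
    simp [Ring.choose_zero_succ]

theorem half_rec (A B : VertexOperator ℂ M) (k l m : ℤ) :
    half A B (k + 1) l m - half A B k (l + 1) m = half A B k l (m + 1) := by
  ext v
  obtain ⟨N, hN⟩ := eventually_zero B v
  rw [LinearMap.sub_apply, half_apply_sum _ _ _ _ _ _ (N + l.natAbs + 1) (by intro n hn; exact hN _ (by omega)),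
    half_apply_sum _ _ _ _ _ _ (N + l.natAbs) (by intro n hn; exact hN _ (by omega)),
    half_apply_sum _ _ _ _ _ _ (N + l.natAbs + 1) (by intro n hn; exact hN _ (by omega)),
    Finset.sum_range_succ', Finset.sum_range_succ' (fun i : ℕ => ((-1) ^ i * Ring.choose (m + 1) i) • _),
    add_sub_right_comm, ← Finset.sum_sub_distrib]
  congr 1
  · apply Finset.sum_congr rfl
    intro i _
    rw [Ring.choose_succ_succ, show k + m - (i : ℤ) = k + 1 + m - ((i + 1 : ℕ) : ℤ) by push_cast; ring,
      show k + (m + 1) - ((i + 1 : ℕ) : ℤ) = k + 1 + m - ((i + 1 : ℕ) : ℤ) by push_cast; ring,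
      show l + 1 + (i : ℤ) = l + ((i + 1 : ℕ) : ℤ) by push_cast; ring, pow_succ]
    module
  · simp [show k + 1 + m = k + (m + 1) by ring]

theorem bracket_rec (A B : VertexOperator ℂ M) (k l m : ℤ) :
    bracket A B (k + 1) l m - bracket A B k (l + 1) m = bracket A B k l (m + 1) := by
  simp only [bracket, ← half_rec, Int.negOnePow_succ]
  push_cast
  module

theorem bracket_zero_right (A B : VertexOperator ℂ M) (k l : ℤ) :
    bracket A B k l 0 = (A[[k]]) * (B[[l]]) - (B[[l]]) * (A[[k]]) := by
  simp [bracket, half_zero_right]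

theorem bracket_swap (A B : VertexOperator ℂ M) (k l m : ℤ) :
    bracket B A l k m = -((m.negOnePow : ℤ) • bracket A B k l m) := by
  have : (m.negOnePow : ℤ) * m.negOnePow = 1 := by
    rcases Int.even_or_odd m with h | h
    · simp [Int.negOnePow_even _ h]
    · simp [Int.negOnePow_odd _ h]
  simp only [bracket, smul_sub, smul_smul, this]
  module

/-- The residual `m`-th product `A(z)_(m) B(z)` of two fields. -/
def residualProduct (m : ℤ) (A B : VertexOperator ℂ M) : VertexOperator ℂ M :=
  ofModes (fun n => bracket A B 0 n m) (by
    intro v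
    obtain ⟨N, hN⟩ := eventually_zero B v
    obtain ⟨N', hN'⟩ := eventually_zero A v
    choose K hK using fun i : ℕ => eventually_zero B ((A[[0 + i]]) v)
    refine ⟨N + N' + m.natAbs + ∑ i ∈ Finset.range N', K i, fun n hn => ?_⟩
    have h0 : 0 ≤ ∑ i ∈ Finset.range N', (K i : ℤ) := Finset.sum_nonneg (by intros; positivity)
    rw [bracket, LinearMap.sub_apply, LinearMap.smul_apply,
      half_apply_sum A B _ _ _ _ 0 (by intro n hn; exact hN _ (by push_cast at hn; omega)),
      half_apply_sum B A _ _ _ _ N' (by intro n hn; exact hN' _ (by omega))]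
    rw [Finset.sum_eq_zero (s := Finset.range N')]
    · simp
    · intro i hi
      rw [hK i _ _, smul_zero]
      have h1 : (K i : ℤ) ≤ ∑ i ∈ Finset.range N', (K i : ℤ) :=
        Finset.single_le_sum (f := fun i => (K i : ℤ)) (by intros; positivity) hi
      have := Finset.mem_range.1 hi
      have h2 := neg_abs_le m
      push_cast at hn
      omega)

theorem residualProduct_ncoeff (m : ℤ) (A B : VertexOperator ℂ M) (n : ℤ) :
    ((residualProduct m A B)[[n]]) = bracket A B 0 n m := by
  simp [residualProduct]

/-- Mutual locality: `(y-z)^N [A(y), B(z)] = 0` for some `N`. -/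
def IsLocal (A B : VertexOperator ℂ M) : Prop :=
  ∃ N : ℕ, ∀ k l : ℤ, bracket A B k l N = 0

theorem bracket_zero_of_le {A B : VertexOperator ℂ M} {N : ℕ}
    (h : ∀ k l : ℤ, bracket A B k l N = 0) (m : ℤ) (hm : N ≤ m) (k l : ℤ) :
    bracket A B k l m = 0 := by
  obtain ⟨j, rfl⟩ := Int.le.dest hm
  clear hm
  induction j generalizing k l with
  | zero => simpa using h k l
  | succ j ih =>
    rw [show (N : ℤ) + (j + 1 : ℕ) = N + j + 1 by push_cast; ring, ← bracket_rec,
      ih, ih, sub_zero]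

theorem IsLocal.symm {A B : VertexOperator ℂ M} (h : IsLocal A B) : IsLocal B A := by
  obtain ⟨N, hN⟩ := h
  exact ⟨N, fun k l => by rw [bracket_swap, hN]; simp⟩

/-- The difference operator on doubly indexed families: multiplication by `y - z`. -/
def diffOp {X : Type*} [AddCommGroup X] (F : ℤ → ℤ → X) (k l : ℤ) : X := F (k + 1) l - F k (l + 1)

theorem diffOp_iterate_map {X X' : Type*} [AddCommGroup X] [AddCommGroup X'] (φ : X →+ X')
    (F : ℤ → ℤ → X) (N : ℕ) :
    diffOp^[N] (fun k l => φ (F k l)) = fun k l => φ (diffOp^[N] F k l) := by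
  induction N with
  | zero => rfl
  | succ N ih =>
    funext k l
    rw [Function.iterate_succ_apply', ih, Function.iterate_succ_apply']
    simp [diffOp]

theorem diffOp_iterate_add {X : Type*} [AddCommGroup X] (F G : ℤ → ℤ → X) (N : ℕ) :
    diffOp^[N] (fun k l => F k l + G k l) = fun k l => diffOp^[N] F k l + diffOp^[N] G k l := by
  induction N with
  | zero => rfl
  | succ N ih =>
    funext k l
    rw [Function.iterate_succ_apply', ih, Function.iterate_succ_apply', Function.iterate_succ_apply']
    simp [diffOp]
    abel

theorem bracket_nat (A B : VertexOperator ℂ M) (N : ℕ) :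
    (fun k l => bracket A B k l N) =
      diffOp^[N] (fun k l => (A[[k]]) * (B[[l]]) - (B[[l]]) * (A[[k]])) := by
  induction N with
  | zero => funext k l; simp [bracket_zero_right]
  | succ N ih =>
    rw [Function.iterate_succ_apply', ← ih]
    funext k l
    simp [diffOp, bracket_rec]

theorem isLocal_iff {A B : VertexOperator ℂ M} :
    IsLocal A B ↔
      ∃ N : ℕ, ∀ m ≥ N, diffOp^[m] (fun k l => (A[[k]]) * (B[[l]]) - (B[[l]]) * (A[[k]])) = 0 := by
  constructor
  · rintro ⟨N, hN⟩
    refine ⟨N, fun m hm => ?_⟩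
    rw [← bracket_nat]
    funext k l
    exact bracket_zero_of_le hN _ (by exact_mod_cast hm) k l
  · rintro ⟨N, hN⟩
    refine ⟨N, fun k l => ?_⟩
    have := hN N le_rfl
    rw [← bracket_nat] at this
    exact congrFun (congrFun this k) l

theorem IsLocal.add {A B C : VertexOperator ℂ M} (h : IsLocal A C) (h' : IsLocal B C) :
    IsLocal (A + B) C := by
  rw [isLocal_iff] at *
  obtain ⟨N, hN⟩ := h
  obtain ⟨N', hN'⟩ := h'
  refine ⟨max N N', fun m hm => ?_⟩
  have e := diffOp_iterate_add (fun k l => (A[[k]]) * (C[[l]]) - (C[[l]]) * (A[[k]]))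
    (fun k l => (B[[k]]) * (C[[l]]) - (C[[l]]) * (B[[k]])) m
  rw [hN m (le_trans (le_max_left _ _) hm), hN' m (le_trans (le_max_right _ _) hm)] at e
  convert e using 2
  · funext k l
    simp only [map_add, Pi.add_apply]
    noncomm_ring
  · simp; rfl

theorem IsLocal.smul {A C : VertexOperator ℂ M} (c : ℂ) (h : IsLocal A C) :
    IsLocal (c • A) C := by
  rw [isLocal_iff] at *
  obtain ⟨N, hN⟩ := h
  refine ⟨N, fun m hm => ?_⟩
  have e := diffOp_iterate_map (DistribSMul.toAddMonoidHom (Module.End ℂ M) c)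
    (fun k l => (A[[k]]) * (C[[l]]) - (C[[l]]) * (A[[k]])) m
  rw [hN m hm] at e
  convert e using 2
  · funext k l
    simp [smul_sub]
  · simp; rfl

theorem IsLocal.sub {A B C : VertexOperator ℂ M} (h : IsLocal A C) (h' : IsLocal B C) :
    IsLocal (A - B) C := by
  have e : A - B = A + (-1 : ℂ) • B := ext_modes fun n => by
    simp only [map_sub, map_add, map_smul, Pi.sub_apply, Pi.add_apply, Pi.smul_apply]
    module
  rw [e]
  exact h.add (h'.smul (-1))

theorem IsLocal.zero (C : VertexOperator ℂ M) : IsLocal 0 C :=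
  ⟨0, fun k l => by simp [bracket_zero_right]⟩

theorem IsLocal.sum {ι : Type*} {s : Finset ι} {A : ι → VertexOperator ℂ M}
    {C : VertexOperator ℂ M} (h : ∀ i ∈ s, IsLocal (A i) C) : IsLocal (∑ i ∈ s, A i) C := by
  classical
  induction s using Finset.induction_on with
  | empty => simpa using IsLocal.zero C
  | insert a s ha ih =>
    rw [Finset.sum_insert ha]
    exact (h _ (by simp)).add (ih fun i hi => h i (by simp [hi]))

set_option linter.unusedSectionVars false

/-- Multiplication by `y - w` on families with three indices. -/
def opP (M : Type*) [AddCommGroup M] : Module.End ℤ (ℤ → ℤ → ℤ → M) where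
  toFun F := fun k l p => F (k + 1) l p - F k l (p + 1)
  map_add' F G := by funext k l p; simp; abel
  map_smul' c F := by funext k l p; simp [smul_sub]

/-- Multiplication by `z - w` on families with three indices. -/
def opR (M : Type*) [AddCommGroup M] : Module.End ℤ (ℤ → ℤ → ℤ → M) where
  toFun F := fun k l p => F k (l + 1) p - F k l (p + 1)
  map_add' F G := by funext k l p; simp; abel
  map_smul' c F := by funext k l p; simp [smul_sub]

theorem opP_comm_opR : Commute (opP M) (opR M) := by
  ext F k l p
  simp [opP, opR]
  abel

theorem opP_pow_apply (N : ℕ) (F : ℤ → ℤ → ℤ → M) (k l p : ℤ) :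
    (opP M ^ N) F k l p = diffOp^[N] (fun k p => F k l p) k p := by
  induction N generalizing k p with
  | zero => rfl
  | succ N ih =>
    rw [pow_succ', Function.iterate_succ_apply', Module.End.mul_apply, diffOp, ← ih, ← ih]
    rfl

theorem opR_pow_apply (N : ℕ) (F : ℤ → ℤ → ℤ → M) (k l p : ℤ) :
    (opR M ^ N) F k l p = diffOp^[N] (fun l p => F k l p) l p := by
  induction N generalizing l p with
  | zero => rfl
  | succ N ih =>
    rw [pow_succ', Function.iterate_succ_apply', Module.End.mul_apply, diffOp, ← ih, ← ih]
    rfl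

/-- Interchange of the first two indices. -/
def swapIdx (F : ℤ → ℤ → ℤ → M) : ℤ → ℤ → ℤ → M := fun k l p => F l k p

theorem opP_pow_swap (N : ℕ) (F : ℤ → ℤ → ℤ → M) :
    (opP M ^ N) (swapIdx F) = swapIdx ((opR M ^ N) F) := by
  funext k l p
  rw [opP_pow_apply, swapIdx, opR_pow_apply]
  rfl

theorem opR_pow_swap (N : ℕ) (F : ℤ → ℤ → ℤ → M) :
    (opR M ^ N) (swapIdx F) = swapIdx ((opP M ^ N) F) := by
  funext k l p
  rw [opR_pow_apply, swapIdx, opP_pow_apply]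
  rfl

/-- For each `p`, the family vanishes for large second index, uniformly in the first. -/
def EvZero (F : ℤ → ℤ → ℤ → M) : Prop := ∀ p, ∃ L : ℤ, ∀ k l, L ≤ l → F k l p = 0

theorem EvZero.opP_pow {F : ℤ → ℤ → ℤ → M} (h : EvZero F) (N : ℕ) : EvZero ((opP M ^ N) F) := by
  induction N with
  | zero => exact h
  | succ N ih =>
    intro p
    obtain ⟨L, hL⟩ := ih p
    obtain ⟨L', hL'⟩ := ih (p + 1)
    refine ⟨max L L', fun k l hl => ?_⟩
    rw [pow_succ', Module.End.mul_apply]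
    change (opP M ^ N) F (k + 1) l p - (opP M ^ N) F k l (p + 1) = 0
    rw [hL _ _ (le_trans (le_max_left _ _) hl), hL' _ _ (le_trans (le_max_right _ _) hl), sub_zero]

theorem EvZero.opR_pow {F : ℤ → ℤ → ℤ → M} (h : EvZero F) (N : ℕ) : EvZero ((opR M ^ N) F) := by
  induction N with
  | zero => exact h
  | succ N ih =>
    intro p
    obtain ⟨L, hL⟩ := ih p
    obtain ⟨L', hL'⟩ := ih (p + 1)
    refine ⟨max L L', fun k l hl => ?_⟩
    rw [pow_succ', Module.End.mul_apply]
    change (opR M ^ N) F k (l + 1) p - (opR M ^ N) F k l (p + 1) = 0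
    rw [hL _ _ (by have := le_max_left L L'; omega), hL' _ _ (le_trans (le_max_right _ _) hl),
      sub_zero]

theorem half_commutator_killed {A B C : VertexOperator ℂ M} {N : ℕ}
    (hA : diffOp^[N] (fun k l => (A[[k]]) * (C[[l]]) - (C[[l]]) * (A[[k]])) = 0)
    (hB : diffOp^[N] (fun k l => (B[[k]]) * (C[[l]]) - (C[[l]]) * (B[[k]])) = 0) (v : M) (m : ℤ) :
    (opR M ^ N) ((opP M ^ N) fun k l p =>
      half A B k l m ((C[[p]]) v) - (C[[p]]) (half A B k l m v)) = 0 := by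
  set h : ℤ → ℤ → ℤ → ℤ → M := fun m k l p =>
    half A B k l m ((C[[p]]) v) - (C[[p]]) (half A B k l m v) with hh
  have hrec : ∀ m, h (m + 1) = (opP M - opR M) (h m) := by
    intro m
    funext k l p
    simp only [hh, opP, opR, ← half_rec, LinearMap.sub_apply, LinearMap.coe_mk, AddHom.coe_mk,
      Pi.sub_apply, map_sub]
    abel
  have hev : ∀ m, EvZero (h m) := by
    intro m p
    obtain ⟨N₁, h₁⟩ := eventually_zero B v
    obtain ⟨N₂, h₂⟩ := eventually_zero B ((C[[p]]) v)
    refine ⟨N₁ + N₂, fun k l hl => ?_⟩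
    simp only [hh]
    rw [half_apply_sum _ _ _ _ _ _ 0 (by intro n hn; apply h₂; push_cast at hn; omega),
      half_apply_sum _ _ _ _ _ _ 0 (by intro n hn; apply h₁; push_cast at hn; omega)]
    simp
  set W : ℤ → ℤ → ℤ → ℤ → M := fun m => (opR M ^ N) ((opP M ^ N) (h m)) with hW
  have hWrec : ∀ m, W (m + 1) = (opP M - opR M) (W m) := by
    intro m
    have c1 : Commute (opP M - opR M) (opR M ^ N * opP M ^ N) := by
      apply Commute.mul_right
      · exact ((opP_comm_opR (M := M)).sub_left (Commute.refl _)).pow_right N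
      · exact ((Commute.refl (opP M)).sub_left (opP_comm_opR (M := M)).symm).pow_right N
    have := LinearMap.congr_fun c1.eq (h m)
    simp only [Module.End.mul_apply] at this
    simp only [hW, hrec]
    exact this.symm
  have hWev : ∀ m, EvZero (W m) := fun m => ((hev m).opP_pow N).opR_pow N
  have h0 : W 0 = 0 := by
    have e : h 0 = (fun k l p => (A[[k]]) (((B[[l]]) * (C[[p]]) - (C[[p]]) * (B[[l]])) v)) +
        fun k l p => ((A[[k]]) * (C[[p]]) - (C[[p]]) * (A[[k]])) ((B[[l]]) v) := by
      funext k l p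
      simp [hh, half_zero_right]
    have e1 : (opR M ^ N)
        (fun k l p => (A[[k]]) (((B[[l]]) * (C[[p]]) - (C[[p]]) * (B[[l]])) v)) = 0 := by
      funext k l p
      rw [opR_pow_apply]
      have := diffOp_iterate_map
        ((A[[k]]).toAddMonoidHom.comp (LinearMap.applyₗ (R := ℂ) v).toAddMonoidHom)
        (fun k l => (B[[k]]) * (C[[l]]) - (C[[l]]) * (B[[k]])) N
      rw [hB] at this
      simpa using congrFun (congrFun this l) p
    have e2 : (opP M ^ N)
        (fun k l p => ((A[[k]]) * (C[[p]]) - (C[[p]]) * (A[[k]])) ((B[[l]]) v)) = 0 := by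
      funext k l p
      rw [opP_pow_apply]
      have := diffOp_iterate_map (LinearMap.applyₗ (R := ℂ) ((B[[l]]) v)).toAddMonoidHom
        (fun k l => (A[[k]]) * (C[[l]]) - (C[[l]]) * (A[[k]])) N
      rw [hA] at this
      simpa using congrFun (congrFun this k) p
    simp only [hW]
    rw [e, map_add, e2, add_zero, ← Module.End.mul_apply,
      ← ((opP_comm_opR (M := M)).pow_pow N N).eq, Module.End.mul_apply, e1, map_zero]
  have hdown : ∀ m, W (m + 1) = 0 → W m = 0 := by
    intro m hm
    rw [hWrec] at hm
    have step : ∀ k l p, W m (k + 1) l p = W m k (l + 1) p := by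
      intro k l p
      have := congrFun (congrFun (congrFun hm k) l) p
      simp only [LinearMap.sub_apply, opP, opR, LinearMap.coe_mk, AddHom.coe_mk, Pi.sub_apply,
        Pi.zero_apply] at this
      rw [← sub_eq_zero, ← this]
      abel
    have step' : ∀ (t : ℕ) k l p, W m k l p = W m (k - t) (l + t) p := by
      intro t
      induction t with
      | zero => intro k l p; simp
      | succ t ih =>
        intro k l p
        rw [ih, show k - (t : ℤ) = (k - (t + 1 : ℕ)) + 1 by push_cast; ring, step]
        congr 1
        push_cast; ring
    funext k l p
    obtain ⟨L, hL⟩ := hWev m p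
    rw [step' (L - l).toNat, hL _ _ (by have := Int.self_le_toNat (L - l); omega)]
    rfl
  change W m = 0
  have hup : ∀ n : ℕ, W n = 0 := by
    intro n
    induction n with
    | zero => exact h0
    | succ n ih => push_cast; rw [hWrec, ih, map_zero]
  have hneg : ∀ n : ℕ, W (-n) = 0 := by
    intro n
    induction n with
    | zero => simpa using h0
    | succ n ih => apply hdown; push_cast; simpa using ih
  rcases Int.eq_nat_or_neg m with ⟨n, rfl | rfl⟩
  · exact hup n
  · exact hneg n

theorem pow_kill {X : Type*} [AddCommGroup X] {P R : Module.End ℤ X} (hPR : Commute P R) {x : X}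
    {N N' : ℕ} (h1 : (R ^ N) ((P ^ N) x) = 0) (h2 : ((P - R) ^ N') x = 0) (t a b : ℕ)
    (ht : N + N' ≤ a + b + t) : (R ^ (N + t) * P ^ a * (P - R) ^ b) x = 0 := by
  have hPQ : Commute P (P - R) := (Commute.refl P).sub_right hPR
  have hRQ : Commute R (P - R) := hPR.symm.sub_right (Commute.refl R)
  induction t generalizing a b with
  | zero =>
    by_cases ha : N ≤ a
    · obtain ⟨c, rfl⟩ := Nat.exists_eq_add_of_le ha
      have : R ^ (N + 0) * P ^ (N + c) * (P - R) ^ b = P ^ c * (P - R) ^ b * (R ^ N * P ^ N) := by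
        rw [add_zero, pow_add, ((hPQ.pow_pow c b)).eq]
        have q1 := (hRQ.pow_pow N b).eq
        have q2 := (hPQ.pow_pow N b).eq
        have q3 := (hPQ.pow_pow c b).eq
        have q4 := (hPR.pow_pow c N).eq
        have q5 := ((Commute.refl P).pow_pow N c).eq
        calc R ^ N * (P ^ N * P ^ c) * (P - R) ^ b
            = R ^ N * P ^ N * (P ^ c * (P - R) ^ b) := by noncomm_ring
          _ = R ^ N * (P ^ N * (P - R) ^ b) * P ^ c := by rw [q3]; noncomm_ring
          _ = (R ^ N * (P - R) ^ b) * (P ^ N * P ^ c) := by rw [q2]; noncomm_ring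
          _ = (P - R) ^ b * (R ^ N * P ^ c) * P ^ N := by rw [q1, q5]; noncomm_ring
          _ = _ := by rw [← q4]; noncomm_ring
      rw [this, Module.End.mul_apply, Module.End.mul_apply, Module.End.mul_apply, h1, map_zero,
        map_zero]
    · obtain ⟨c, rfl⟩ := Nat.exists_eq_add_of_le (show N' ≤ b by omega)
      rw [add_comm N', pow_add (P - R), ← mul_assoc, Module.End.mul_apply, h2, map_zero]
  | succ t ih =>
    have e : R ^ (N + (t + 1)) * P ^ a * (P - R) ^ b =
        R ^ (N + t) * P ^ (a + 1) * (P - R) ^ b - R ^ (N + t) * P ^ a * (P - R) ^ (b + 1) := by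
      have q1 := (hPR.pow_left a).eq
      rw [show N + (t + 1) = N + t + 1 by ring, pow_succ, pow_succ P, pow_succ' (P - R),
        mul_assoc (R ^ (N + t)) R, ← q1]
      noncomm_ring
    rw [e, LinearMap.sub_apply, ih _ _ (by omega), ih _ _ (by omega), sub_zero]

/-- Dong's lemma. -/
theorem IsLocal.residualProduct {A B C : VertexOperator ℂ M} (hAB : IsLocal A B)
    (hAC : IsLocal A C) (hBC : IsLocal B C) (m : ℤ) :
    IsLocal (residualProduct m A B) C := by
  obtain ⟨N₀, hN₀⟩ := hAB
  obtain ⟨N₁, hN₁⟩ := isLocal_iff.1 hAC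
  obtain ⟨N₂, hN₂⟩ := isLocal_iff.1 hBC
  set N := max N₁ N₂
  have hA := hN₁ N (le_max_left _ _)
  have hB := hN₂ N (le_max_right _ _)
  set N' := N₀ + m.natAbs with hN'
  rw [isLocal_iff]
  refine ⟨N + (N + N'), fun t ht => ?_⟩
  obtain ⟨t, rfl⟩ := Nat.exists_eq_add_of_le (le_trans (Nat.le_add_right N (N + N')) ht)
  have key : ∀ v : M, (opR M ^ (N + t)) (fun k l p =>
      bracket A B k l m ((C[[p]]) v) - (C[[p]]) (bracket A B k l m v)) = 0 := by
    intro v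
    set H : ℤ → ℤ → ℤ → ℤ → M := fun m k l p =>
      bracket A B k l m ((C[[p]]) v) - (C[[p]]) (bracket A B k l m v) with hH
    have hrec : ∀ m, H (m + 1) = (opP M - opR M) (H m) := by
      intro m
      funext k l p
      simp only [hH, opP, opR, ← bracket_rec, LinearMap.sub_apply, LinearMap.coe_mk, AddHom.coe_mk,
        Pi.sub_apply, map_sub]
      abel
    have hpow : ∀ n : ℕ, ((opP M - opR M) ^ n) (H m) = H (m + n) := by
      intro n
      induction n with
      | zero => simp
      | succ n ih =>
        rw [pow_succ', Module.End.mul_apply, ih, ← hrec]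
        congr 1
        push_cast; ring
    have h2 : ((opP M - opR M) ^ N') (H m) = 0 := by
      rw [hpow]
      funext k l p
      simp only [hH]
      rw [bracket_zero_of_le hN₀ _ (by omega)]
      simp
    have h1 : (opR M ^ N) ((opP M ^ N) (H m)) = 0 := by
      have e : H m = (fun k l p => half A B k l m ((C[[p]]) v) - (C[[p]]) (half A B k l m v)) -
          (m.negOnePow : ℤ) • swapIdx (fun k l p =>
            half B A k l m ((C[[p]]) v) - (C[[p]]) (half B A k l m v)) := by
        funext k l p
        simp only [hH, bracket, swapIdx, LinearMap.sub_apply, LinearMap.smul_apply, map_sub,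
          map_zsmul, Pi.sub_apply, Pi.smul_apply, smul_sub]
        abel
      rw [e, map_sub, map_sub, map_zsmul, map_zsmul, opP_pow_swap, opR_pow_swap,
        half_commutator_killed hA hB]
      have := half_commutator_killed hB hA v m
      rw [← Module.End.mul_apply, ← ((opP_comm_opR (M := M)).pow_pow N N).eq,
        Module.End.mul_apply] at this
      rw [this]
      funext k l p
      simp [swapIdx]
    have := pow_kill (opP_comm_opR (M := M)) h1 h2 t 0 0 (by omega)
    simpa using this
  funext l p
  ext v
  have h3 := congrFun (congrFun (congrFun (key v) 0) l) p
  rw [opR_pow_apply] at h3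
  have h4 := diffOp_iterate_map (LinearMap.applyₗ (R := ℂ) v).toAddMonoidHom
    (fun l p => ((FormalField.residualProduct m A B)[[l]]) * (C[[p]]) -
      (C[[p]]) * ((FormalField.residualProduct m A B)[[l]])) (N + t)
  have h5 := congrFun (congrFun h4 l) p
  simp only [residualProduct_ncoeff] at h5 ⊢
  simp only [LinearMap.toAddMonoidHom_coe, LinearMap.applyₗ_apply_apply, LinearMap.sub_apply,
    Module.End.mul_apply] at h5
  rw [← h5, h3]
  rfl

theorem choose_absorb (m : ℤ) (i : ℕ) :
    Ring.choose m (i + 1) * (i + 1) = Ring.choose m i * (m - i) := by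
  have := Ring.choose_smul_choose m (Nat.le_succ i)
  simp only [Nat.succ_eq_add_one, Nat.choose_succ_self_right, add_tsub_cancel_left,
    Ring.choose_one_right, nsmul_eq_mul] at this
  push_cast at this
  rw [← this]
  ring

/-- Translation covariance `[T, A(z)] = ∂ A(z)`. -/
def Covariant (T : Module.End ℂ M) (A : VertexOperator ℂ M) : Prop :=
  ∀ n : ℤ, T * (A[[n]]) - (A[[n]]) * T = -(n • (A[[n - 1]]))

theorem half_covariant {T : Module.End ℂ M} {A B : VertexOperator ℂ M} (hA : Covariant T A)
    (hB : Covariant T B) (k l m : ℤ) :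
    T * half A B k l m - half A B k l m * T =
      -(k • half A B (k - 1) l m) - l • half A B k (l - 1) m := by
  ext v
  obtain ⟨N₁, h₁⟩ := eventually_zero B v
  obtain ⟨N₂, h₂⟩ := eventually_zero B (T v)
  have hA' : ∀ n w, T ((A[[n]]) w) = (A[[n]]) (T w) - n • (A[[n - 1]]) w := by
    intro n w
    have := LinearMap.congr_fun (hA n) w
    simp only [LinearMap.sub_apply, Module.End.mul_apply, LinearMap.neg_apply,
      LinearMap.smul_apply] at this
    rw [sub_eq_iff_eq_add] at this
    rw [this]; abel
  have hB' : ∀ n w, T ((B[[n]]) w) = (B[[n]]) (T w) - n • (B[[n - 1]]) w := by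
    intro n w
    have := LinearMap.congr_fun (hB n) w
    simp only [LinearMap.sub_apply, Module.End.mul_apply, LinearMap.neg_apply,
      LinearMap.smul_apply] at this
    rw [sub_eq_iff_eq_add] at this
    rw [this]; abel
  obtain ⟨K, hK⟩ : ∃ K, K = N₁ + N₂ + l.natAbs + 1 := ⟨_, rfl⟩
  simp only [LinearMap.sub_apply, Module.End.mul_apply, LinearMap.neg_apply, LinearMap.smul_apply]
  rw [half_apply_sum A B k l m v K (by intro n hn; apply h₁; omega),
    half_apply_sum A B k l m (T v) K (by intro n hn; apply h₂; omega),
    half_apply_sum A B (k - 1) l m v K (by intro n hn; apply h₁; omega),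
    half_apply_sum A B k (l - 1) m v (K + 1) (by intro n hn; apply h₁; omega), map_sum,
    ← Finset.sum_sub_distrib, Finset.smul_sum, Finset.sum_range_succ', smul_add, Finset.smul_sum,
    ← sub_sub, ← Finset.sum_neg_distrib, ← Finset.sum_sub_distrib]
  rw [Finset.sum_congr rfl (g := fun i : ℕ =>
    (-(((-1) ^ i * Ring.choose m i * (k + m - i)) • (A[[k + m - i - 1]]) ((B[[l + i]]) v)) -
      ((-1) ^ i * Ring.choose m i * (l + i)) • (A[[k + m - i]]) ((B[[l + i - 1]]) v)))]
  swap
  · intro i _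
    rw [map_zsmul, hA', hB', map_sub, map_zsmul]
    module
  rw [Finset.sum_sub_distrib, show ∑ i ∈ Finset.range K, ((-1) ^ i * Ring.choose m i * (l + i)) •
      (A[[k + m - i]]) ((B[[l + i - 1]]) v) = ∑ i ∈ Finset.range (K + 1),
      ((-1) ^ i * Ring.choose m i * (l + i)) • (A[[k + m - i]]) ((B[[l + i - 1]]) v) by
    rw [Finset.sum_range_succ, h₁ (l + K - 1) (by omega)]; simp, Finset.sum_range_succ', ← sub_sub,
    ← Finset.sum_sub_distrib]
  congr 1
  · apply Finset.sum_congr rfl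
    intro i _
    rw [show k + m - (i : ℤ) - 1 = k + m - ((i + 1 : ℕ) : ℤ) by push_cast; ring,
      show k - 1 + m - (i : ℤ) = k + m - ((i + 1 : ℕ) : ℤ) by push_cast; ring,
      show l + ((i + 1 : ℕ) : ℤ) - 1 = l + i by push_cast; ring,
      show l - 1 + ((i + 1 : ℕ) : ℤ) = l + i by push_cast; ring]
    have e := choose_absorb m i
    push_cast
    simp only [smul_smul, ← neg_smul, ← sub_smul]
    congr 1
    rw [pow_succ]
    linear_combination (-1) ^ i * e
  · simp [sub_eq_add_neg]

theorem Covariant.residualProduct {T : Module.End ℂ M} {A B : VertexOperator ℂ M}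
    (hA : Covariant T A) (hB : Covariant T B) (m : ℤ) : Covariant T (residualProduct m A B) := by
  intro n
  rw [residualProduct_ncoeff, residualProduct_ncoeff, bracket, bracket]
  have h1 := half_covariant hA hB 0 n m
  have h2 := half_covariant hB hA n 0 m
  rw [mul_sub, sub_mul, mul_smul_comm, smul_mul_assoc, sub_sub_sub_comm, h1, ← smul_sub, h2]
  module

theorem Covariant.sub {T : Module.End ℂ M} {A B : VertexOperator ℂ M}
    (hA : Covariant T A) (hB : Covariant T B) : Covariant T (A - B) := by
  intro n
  simp only [map_sub, Pi.sub_apply, mul_sub, sub_mul]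
  rw [sub_sub_sub_comm, hA, hB]
  module

theorem Covariant.add {T : Module.End ℂ M} {A B : VertexOperator ℂ M}
    (hA : Covariant T A) (hB : Covariant T B) : Covariant T (A + B) := by
  intro n
  simp only [map_add, Pi.add_apply, mul_add, add_mul]
  rw [add_sub_add_comm, hA, hB]
  module

theorem Covariant.smul {T : Module.End ℂ M} {A : VertexOperator ℂ M} (c : ℂ)
    (hA : Covariant T A) : Covariant T (c • A) := by
  intro n
  simp only [map_smul, Pi.smul_apply, mul_smul_comm, smul_mul_assoc]
  rw [← smul_sub, hA]
  module

theorem Covariant.sum {T : Module.End ℂ M} {ι : Type*} {s : Finset ι}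
    {A : ι → VertexOperator ℂ M} (h : ∀ i ∈ s, Covariant T (A i)) :
    Covariant T (∑ i ∈ s, A i) := by
  classical
  induction s using Finset.induction_on with
  | empty => intro n; simp
  | insert a s ha ih =>
    rw [Finset.sum_insert ha]
    exact (h _ (by simp)).add (ih fun i hi => h i (by simp [hi]))

/-- A translation covariant field killing the vacuum that is local with the fields of a
state-field correspondence vanishes. -/
theorem eq_zero_of_isLocal {T : Module.End ℂ M} {v : M} (hT : T v = 0)
    {Y : M →ₗ[ℂ] VertexOperator ℂ M} (hY0 : ∀ a, ∀ n : ℤ, 0 ≤ n → ((Y a)[[n]]) v = 0)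
    (hY1 : ∀ a, ((Y a)[[-1]]) v = a) {B : VertexOperator ℂ M} (hBT : Covariant T B)
    (hB0 : ∀ n : ℤ, -1 ≤ n → (B[[n]]) v = 0) (hloc : ∀ a, IsLocal B (Y a)) : B = 0 := by
  have hB : ∀ j : ℕ, (B[[-1 - (j : ℤ)]]) v = 0 := by
    intro j
    induction j with
    | zero => simpa using hB0 (-1) le_rfl
    | succ j ih =>
      have := LinearMap.congr_fun (hBT (-1 - j)) v
      simp only [LinearMap.sub_apply, Module.End.mul_apply, ih, hT, map_zero, sub_zero,
        LinearMap.neg_apply, LinearMap.smul_apply] at this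
      rw [eq_comm, neg_eq_zero, ← Int.cast_smul_eq_zsmul ℂ, smul_eq_zero] at this
      rcases this with h | h
      · exfalso
        have : (-1 - (j : ℤ)) = 0 := by exact_mod_cast h
        omega
      · rw [← h, show -1 - ((j + 1 : ℕ) : ℤ) = -1 - (j : ℤ) - 1 by push_cast; ring]
  have hB' : ∀ n : ℤ, (B[[n]]) v = 0 := by
    intro n
    by_cases hn : -1 ≤ n
    · exact hB0 n hn
    · have := hB (-1 - n).toNat
      rwa [Int.toNat_of_nonneg (by omega), show -1 - (-1 - n) = n by ring] at this
  apply ext_modes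
  intro n
  ext a
  obtain ⟨N, hN⟩ := hloc a
  have := LinearMap.congr_fun (hN (n - N) (-1)) v
  rw [bracket, LinearMap.sub_apply, LinearMap.smul_apply,
    half_apply_sum B (Y a) _ _ _ _ 1 (by intro n hn; apply hY0; push_cast at hn; omega),
    half_apply, finsum_nat _ 0 (by intro i _; rw [hB']; simp)] at this
  simpa [hY1] using this

theorem borcherds_aux {X : Type*} [AddCommGroup X] (g : ℤ → ℤ → ℤ → X)
    (hg : ∀ k l m, g (k + 1) l m - g k (l + 1) m = g k l (m + 1)) (N : ℕ)
    (hN : ∀ k l m : ℤ, N ≤ m → g k l m = 0) (k l m : ℤ) :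
    ∑ᶠ i : ℕ, Ring.choose k i • g 0 (k + l - i) (m + i) = g k l m := by
  have hsum : ∀ (k l m : ℤ) (K : ℕ), N ≤ m + K →
      ∑ᶠ i : ℕ, Ring.choose k i • g 0 (k + l - i) (m + i) =
        ∑ i ∈ Finset.range K, Ring.choose k i • g 0 (k + l - i) (m + i) := by
    intro k l m K hK
    apply finsum_nat
    intro i hi
    rw [hN _ _ _ (by omega), smul_zero]
  set E : ℤ → ℤ → ℤ → X := fun k l m =>
    (∑ᶠ i : ℕ, Ring.choose k i • g 0 (k + l - i) (m + i)) - g k l m with hE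
  have hrec : ∀ k l m, E (k + 1) l m = E k (l + 1) m + E k l (m + 1) := by
    intro k l m
    simp only [hE]
    set K := N + m.natAbs
    rw [hsum (k + 1) l m (K + 1) (by omega), hsum k (l + 1) m (K + 1) (by omega),
      hsum k l (m + 1) K (by omega), ← hg, Finset.sum_range_succ', Finset.sum_range_succ']
    have : ∑ i ∈ Finset.range K, Ring.choose (k + 1) (i + 1) •
          g 0 (k + 1 + l - ((i + 1 : ℕ) : ℤ)) (m + ((i + 1 : ℕ) : ℤ)) =
        ∑ i ∈ Finset.range K, Ring.choose k (i + 1) •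
          g 0 (k + (l + 1) - ((i + 1 : ℕ) : ℤ)) (m + ((i + 1 : ℕ) : ℤ)) +
        ∑ i ∈ Finset.range K, Ring.choose k i • g 0 (k + l - i) (m + 1 + i) := by
      rw [← Finset.sum_add_distrib]
      apply Finset.sum_congr rfl
      intro i _
      rw [Ring.choose_succ_succ,
        show k + 1 + l - ((i + 1 : ℕ) : ℤ) = k + l - i by push_cast; ring,
        show k + (l + 1) - ((i + 1 : ℕ) : ℤ) = k + l - i by push_cast; ring,
        show m + ((i + 1 : ℕ) : ℤ) = m + 1 + i by push_cast; ring]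
      module
    rw [this]
    simp only [Ring.choose_zero_right, one_smul, Nat.cast_zero, add_zero, sub_zero,
      show k + 1 + l = k + (l + 1) by ring]
    abel
  have h0 : ∀ l m, E 0 l m = 0 := by
    intro l m
    simp only [hE]
    rw [finsum_nat _ 1]
    · simp
    · intro i hi
      obtain ⟨j, rfl⟩ : ∃ j, i = j + 1 := ⟨i - 1, by omega⟩
      simp [Ring.choose_zero_succ]
  have hlarge : ∀ k l m : ℤ, N ≤ m → E k l m = 0 := by
    intro k l m hm
    simp only [hE]
    rw [hsum k l m 0 (by simpa using hm), hN _ _ _ hm]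
    simp
  have hup : ∀ (n : ℕ) l m, E n l m = 0 := by
    intro n
    induction n with
    | zero => simpa using h0
    | succ n ih => intro l m; push_cast; rw [hrec, ih, ih, add_zero]
  have hdown : ∀ k, (∀ l m, E (k + 1) l m = 0) → ∀ l m, E k l m = 0 := by
    intro k hk
    have : ∀ (t : ℕ) (l m : ℤ), N ≤ m + t → E k l m = 0 := by
      intro t
      induction t with
      | zero => intro l m h; exact hlarge _ _ _ (by simpa using h)
      | succ t ih =>
        intro l m h
        have e := hrec k (l - 1) m
        rw [hk, ih (l - 1) (m + 1) (by push_cast at h; omega), add_zero, sub_add_cancel] at e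
        exact e.symm
    intro l m
    exact this (N + m.natAbs) l m (by omega)
  have hneg : ∀ (n : ℕ) l m, E (-n) l m = 0 := by
    intro n
    induction n with
    | zero => simpa using h0
    | succ n ih => apply hdown; push_cast; simpa using ih
  have hall : E k l m = 0 := by
    rcases Int.eq_nat_or_neg k with ⟨n, rfl | rfl⟩
    · exact hup n l m
    · exact hneg n l m
  exact sub_eq_zero.1 hall

theorem residualProduct_vacuum {A B : VertexOperator ℂ M} {v : M}
    (hA : ∀ n : ℤ, 0 ≤ n → (A[[n]]) v = 0) (hB : ∀ n : ℤ, 0 ≤ n → (B[[n]]) v = 0) (m : ℤ) :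
    (∀ n : ℤ, 0 ≤ n → ((residualProduct m A B)[[n]]) v = 0) ∧
      ((residualProduct m A B)[[-1]]) v = (A[[m]]) ((B[[-1]]) v) := by
  simp only [residualProduct_ncoeff, bracket, LinearMap.sub_apply, LinearMap.smul_apply]
  constructor
  · intro n hn
    rw [half_apply_sum B A _ _ _ _ 0 (by intro n hn; apply hA; push_cast at hn; omega),
      half_apply_sum A B _ _ _ _ 0 (by intro n hn; apply hB; push_cast at hn; omega)]
    simp
  · rw [half_apply_sum B A _ _ _ _ 0 (by intro n hn; apply hA; push_cast at hn; omega),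
      half_apply_sum A B _ _ _ _ 1 (by intro n hn; apply hB; push_cast at hn; omega)]
    simp

/-- A state-field correspondence with pairwise local, translation covariant fields satisfying the
vacuum axioms gives a vertex algebra. -/
def vertexAlgebraOfLocal (T : Module.End ℂ M) (v : M) (hT : T v = 0)
    (Y : M →ₗ[ℂ] VertexOperator ℂ M) (hY0 : ∀ a, ∀ n : ℤ, 0 ≤ n → ((Y a)[[n]]) v = 0)
    (hY1 : ∀ a, ((Y a)[[-1]]) v = a) (hYT : ∀ a, Covariant T (Y a))
    (hloc : ∀ a b, IsLocal (Y a) (Y b)) : VertexAlgebra M where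
  vacuum := v
  Y := Y
  vacuum_nonneg := hY0
  vacuum_neg_one := hY1
  borcherds a b c k l m := by
    have hprod : ∀ m : ℤ, Y (((Y a)[[m]]) b) = residualProduct m (Y a) (Y b) := by
      intro m
      rw [eq_comm, ← sub_eq_zero]
      have hloc' : ∀ c, IsLocal
          (residualProduct m (Y a) (Y b) - Y (((Y a)[[m]]) b)) (Y c) := by
        intro c
        exact ((hloc a b).residualProduct (hloc a c) (hloc b c) m).sub (hloc _ c)
      refine eq_zero_of_isLocal hT hY0 hY1 (((hYT a).residualProduct (hYT b) m).sub (hYT _))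
        ?_ hloc'
      intro n hn
      obtain ⟨h1, h2⟩ := residualProduct_vacuum (hY0 a) (hY0 b) m
      rw [map_sub, Pi.sub_apply, LinearMap.sub_apply]
      rcases eq_or_lt_of_le hn with rfl | hn
      · rw [h2, hY1, hY1, sub_self]
      · rw [h1 _ (by omega), hY0 _ n (by omega), sub_self]
    obtain ⟨N, hN⟩ := hloc a b
    have key := borcherds_aux (fun k l m => bracket (Y a) (Y b) k l m c)
      (fun k l m => by rw [← bracket_rec]; rfl) N
      (fun k l m hm => by rw [bracket_zero_of_le hN m hm]; rfl) k l m
    simp only [hprod, residualProduct_ncoeff]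
    rw [key, bracket, LinearMap.sub_apply, LinearMap.smul_apply]
    obtain ⟨N₁, h₁⟩ := eventually_zero (Y a) c
    obtain ⟨N₂, h₂⟩ := eventually_zero (Y b) c
    set K := N₁ + N₂ + k.natAbs + l.natAbs
    rw [half_apply_sum (Y a) (Y b) _ _ _ _ K (by intro n hn; apply h₂; omega),
      half_apply_sum (Y b) (Y a) _ _ _ _ K (by intro n hn; apply h₁; omega), finsum_nat _ K,
      Finset.smul_sum, ← Finset.sum_sub_distrib]
    · apply Finset.sum_congr rfl
      intro i _
      module
    · intro i hi
      rw [h₁ _ (by omega), h₂ _ (by omega)]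
      simp

/-- The identity field `I(z) = id`. -/
def identityField (M : Type*) [AddCommGroup M] [Module ℂ M] : VertexOperator ℂ M :=
  ofModes (fun n => if n = -1 then 1 else 0) fun v => ⟨0, fun n hn => by
    rw [if_neg (by omega)]; rfl⟩

theorem identityField_ncoeff (n : ℤ) :
    ((identityField M)[[n]]) = if n = -1 then 1 else 0 := by
  simp [identityField]

theorem isLocal_identityField (A : VertexOperator ℂ M) : IsLocal (identityField M) A := by
  refine ⟨0, fun k l => ?_⟩
  rw [Nat.cast_zero, bracket_zero_right, identityField_ncoeff]
  split_ifs <;> simp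

theorem covariant_identityField (T : Module.End ℂ M) : Covariant T (identityField M) := by
  intro n
  rw [identityField_ncoeff, identityField_ncoeff]
  split_ifs with h1 h2
  · omega
  · simp
  · obtain rfl : n = 0 := by omega
    simp
  · simp

end FormalField

/-- A (normalized) Heisenberg field: a field whose Fourier modes satisfy
`[α_m, α_n] = m δ_{m+n,0}`. -/
def IsHeisenbergField {M : Type*} [AddCommGroup M] [Module ℂ M] (A : VertexOperator ℂ M) : Prop :=
  ∀ m n : ℤ, ncoeff A m * ncoeff A n - ncoeff A n * ncoeff A m =
    if m + n = 0 then (m : ℂ) • (1 : Module.End ℂ M) else 0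

/-- A (normalized) Heisenberg vector: an element `h` such that `Y(h,z)` is a Heisenberg field. -/
def VertexAlgebra.IsHeisenbergVector {V : Type*} [AddCommGroup V] [Module ℂ V]
    (𝒱 : VertexAlgebra V) (h : V) : Prop :=
  IsHeisenbergField (𝒱.Y h)

/-- The underlying space `ℂ[x_1, x_2, …]` of the Fock representation. -/
abbrev Fock : Type := MvPolynomial ℕ+ ℂ

namespace FreeBoson

open MvPolynomial FormalField

/-- The action of `α_n` on the Fock space of charge `0`: `n ∂/∂x_n` for `n > 0`, zero for `n = 0`
and multiplication by `x_{-n}` for `n < 0`. -/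
def mode : ℤ → Module.End ℂ Fock
  | Int.ofNat 0 => 0
  | Int.ofNat (n + 1) => ((n + 1 : ℕ) : ℂ) • (pderiv n.succPNat : Derivation ℂ Fock Fock).toLinearMap
  | Int.negSucc n => LinearMap.mulLeft ℂ (X n.succPNat)

theorem mode_zero : mode 0 = 0 := rfl

theorem mode_pos (i : ℕ+) (p : Fock) : mode (i : ℤ) p = (i : ℂ) • pderiv i p := by
  obtain ⟨n, rfl⟩ : ∃ n : ℕ, i = n.succPNat := ⟨i.natPred, by simp⟩
  rfl

theorem mode_neg (i : ℕ+) (p : Fock) : mode (-(i : ℤ)) p = X i * p := by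
  obtain ⟨n, rfl⟩ : ∃ n : ℕ, i = n.succPNat := ⟨i.natPred, by simp⟩
  rfl

theorem mode_cases {P : ℤ → Prop} (h0 : P 0) (hp : ∀ i : ℕ+, P (i : ℤ))
    (hn : ∀ i : ℕ+, P (-(i : ℤ))) (n : ℤ) : P n := by
  match n with
  | Int.ofNat 0 => exact h0
  | Int.ofNat (n + 1) => exact hp n.succPNat
  | Int.negSucc n => exact hn n.succPNat

theorem mode_eventually_zero (p : Fock) : ∃ N : ℤ, ∀ n, N ≤ n → mode n p = 0 := by
  refine ⟨1 + ∑ i ∈ p.vars, (i : ℤ), fun n hn => ?_⟩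
  have h0 : 0 ≤ ∑ i ∈ p.vars, (i : ℤ) := Finset.sum_nonneg (by intros; positivity)
  induction n using mode_cases with
  | h0 => rfl
  | hn i => have := i.pos; omega
  | hp i =>
    rw [mode_pos, pderiv_eq_zero_of_notMem_vars, smul_zero]
    intro hi
    have := Finset.single_le_sum (f := fun i : ℕ+ => (i : ℤ)) (by intros; positivity) hi
    omega

/-- The Heisenberg field `α(z) = ∑ α_n z^(-n-1)` on the Fock space of charge `0`. -/
def field : VertexOperator ℂ Fock := ofModes mode mode_eventually_zero

theorem field_ncoeff (n : ℤ) : ncoeff field n = mode n := ofModes_ncoeff _ _ _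

theorem isHeisenbergField_field : IsHeisenbergField field := by
  intro m n
  simp only [field_ncoeff]
  apply LinearMap.ext
  intro p
  rw [LinearMap.sub_apply, Module.End.mul_apply, Module.End.mul_apply]
  induction m using mode_cases with
  | h0 => simp [mode_zero]
  | hp i =>
    induction n using mode_cases with
    | h0 =>
      have := i.pos
      rw [if_neg (by omega)]; simp [mode_zero]
    | hp j =>
      have := i.pos
      have := j.pos
      have e : ⁅(pderiv i : Derivation ℂ Fock Fock), pderiv j⁆ = 0 :=
        derivation_ext fun l => by
          rw [Derivation.commutator_apply, pderiv_X, pderiv_X]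
          simp [Pi.single_apply, apply_ite]
      have e' := DFunLike.congr_fun e p
      rw [Derivation.commutator_apply, Derivation.zero_apply, sub_eq_zero] at e'
      rw [if_neg (by omega)]
      simp only [mode_pos, map_smul, e', smul_comm (i : ℂ) (j : ℂ), sub_self, LinearMap.zero_apply]
    | hn j =>
      simp only [mode_pos, mode_neg, Derivation.leibniz, pderiv_X, smul_eq_mul]
      by_cases hij : i = j
      · subst hij
        simp [smul_eq_C_mul]
        ring
      · rw [if_neg (fun h => hij (PNat.eq (by omega)))]
        simp [Ne.symm hij, smul_eq_C_mul]
        ring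
  | hn i =>
    induction n using mode_cases with
    | h0 =>
      have := i.pos
      rw [if_neg (by omega)]; simp [mode_zero]
    | hp j =>
      simp only [mode_pos, mode_neg, Derivation.leibniz, pderiv_X, smul_eq_mul]
      by_cases hij : i = j
      · subst hij
        simp [smul_eq_C_mul]
        ring
      · rw [if_neg (fun h => hij (PNat.eq (by omega)))]
        simp [hij, smul_eq_C_mul]
        ring
    | hn j =>
      have := i.pos
      have := j.pos
      rw [if_neg (by omega), mode_neg, mode_neg, mode_neg, mode_neg]
      rw [LinearMap.zero_apply]
      ring

/-- The field `α_(-i_1) (α_(-i_2) (⋯ (α_(-i_k) I)))` built with residual products, that is, the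
nested normally ordered product of the fields `∂^(i_1 - 1) α, …, ∂^(i_k - 1) α` (with divided
powers of `∂`). -/
def listField : List ℕ+ → VertexOperator ℂ Fock
  | [] => identityField Fock
  | i :: t => residualProduct (-(i : ℤ)) field (listField t)

/-- The state-field correspondence: the linear map sending `x_{i_1} ⋯ x_{i_k}` to the normally
ordered product of the fields `∂^(i_1 - 1) α, …, ∂^(i_k - 1) α`, taken in increasing order of the
indices. -/
def stateField : Fock →ₗ[ℂ] VertexOperator ℂ Fock :=
  (basisMonomials ℕ+ ℂ).constr ℂ fun s => listField (s.toMultiset.sort (· ≤ ·))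

/-- The translation `T = ∑ n x_{n+1} ∂/∂x_n`. -/
def translation : Derivation ℂ Fock Fock := mkDerivation ℂ fun n : ℕ+ => (n : ℂ) • X (n + 1)

theorem stateField_apply (p : Fock) :
    stateField p = ∑ s ∈ p.support, p.coeff s • listField (s.toMultiset.sort (· ≤ ·)) := by
  rw [stateField, Module.Basis.constr_apply]
  rfl

theorem covariant_field : Covariant translation.toLinearMap field := by
  intro n
  simp only [field_ncoeff]
  apply LinearMap.ext
  intro p
  rw [LinearMap.sub_apply, Module.End.mul_apply, Module.End.mul_apply, LinearMap.neg_apply,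
    LinearMap.smul_apply]
  change translation (mode n p) - mode n (translation p) = _
  induction n using mode_cases with
  | h0 => simp [mode_zero]
  | hp i =>
    have key : ∀ j : ℕ+, translation (pderiv i (X j)) - pderiv i (translation (X j)) =
        -(if i = j + 1 then C (j : ℂ) else 0) := by
      intro j
      rw [pderiv_X, translation, mkDerivation_X, Derivation.map_smul, pderiv_X]
      by_cases h : i = j + 1
      · simp [Pi.single_apply, h, apply_ite, smul_eq_C_mul]
      · simp [Pi.single_apply, h, Ne.symm h, apply_ite]
    rw [mode_pos, mode_pos, Derivation.map_smul, ← smul_sub, ← Derivation.commutator_apply]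
    by_cases hi : i = 1
    · subst hi
      have e : ⁅translation, (pderiv 1 : Derivation ℂ Fock Fock)⁆ = 0 :=
        derivation_ext fun j => by
          rw [Derivation.commutator_apply, key, if_neg]
          · simp
          · intro h
            have := congrArg PNat.val h
            have := j.pos
            simp at *
      rw [e]
      simp [mode_zero]
    · obtain ⟨k, rfl⟩ : ∃ k, i = k + 1 := ⟨i - 1, by
        rw [PNat.sub_add_of_lt]
        exact lt_of_le_of_ne one_le (Ne.symm hi)⟩
      have e : ⁅translation, (pderiv (k + 1) : Derivation ℂ Fock Fock)⁆ =
          -((k : ℂ) • pderiv k) :=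
        derivation_ext fun j => by
          rw [Derivation.commutator_apply, key]
          by_cases h : k = j
          · subst h; simp [smul_eq_C_mul]
          · simp [h, pderiv_X, Ne.symm h]
      rw [e, show (((k + 1 : ℕ+) : ℕ) : ℤ) - 1 = (k : ℤ) by push_cast; ring, mode_pos]
      simp only [Derivation.neg_apply, Derivation.smul_apply, smul_neg]
      congr 1
      rw [← Int.cast_smul_eq_zsmul ℂ]
      simp
  | hn i =>
    rw [show -(i : ℤ) - 1 = -((i + 1 : ℕ+) : ℤ) by push_cast; ring, mode_neg, mode_neg, mode_neg,
      Derivation.leibniz, translation, mkDerivation_X, ← Int.cast_smul_eq_zsmul ℂ]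
    simp only [smul_eq_mul, smul_eq_C_mul]
    simp
    ring

theorem isLocal_field : IsLocal field field := by
  refine ⟨2, fun k l => ?_⟩
  have h := isHeisenbergField_field
  have := congrFun (congrFun (bracket_nat field field 2) k) l
  rw [Function.iterate_succ_apply', Function.iterate_succ_apply', Function.iterate_zero_apply]
    at this
  rw [this]
  have h' : (fun k l => ncoeff field k * ncoeff field l - ncoeff field l * ncoeff field k) =
      fun k l : ℤ => if k + l = 0 then (k : ℂ) • (1 : Module.End ℂ Fock) else 0 := by
    funext k l; exact h k l
  rw [h']
  simp only [diffOp]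
  by_cases e : k + l + 2 = 0
  · rw [if_pos (by omega), if_pos (by omega), if_pos (by omega)]
    push_cast
    module
  · rw [if_neg (by omega), if_neg (by omega), if_neg (by omega)]
    simp

theorem isLocal_field_listField (L : List ℕ+) : IsLocal field (listField L) := by
  induction L with
  | nil => exact (isLocal_identityField _).symm
  | cons i t ih => exact (ih.residualProduct isLocal_field ih.symm _).symm

theorem isLocal_listField (L L' : List ℕ+) : IsLocal (listField L) (listField L') := by
  induction L with
  | nil => exact isLocal_identityField _
  | cons i t ih =>
    exact (isLocal_field_listField t).residualProduct (isLocal_field_listField L') ih _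

theorem covariant_listField (L : List ℕ+) : Covariant translation.toLinearMap (listField L) := by
  induction L with
  | nil => exact covariant_identityField _
  | cons i t ih => exact covariant_field.residualProduct ih _

theorem field_vacuum (n : ℤ) (hn : 0 ≤ n) : ncoeff field n 1 = 0 := by
  rw [field_ncoeff]
  induction n using mode_cases with
  | h0 => rfl
  | hn i => have := i.pos; omega
  | hp i => rw [mode_pos, pderiv_one, smul_zero]

theorem listField_vacuum (L : List ℕ+) :
    (∀ n : ℤ, 0 ≤ n → ncoeff (listField L) n 1 = 0) ∧
      ncoeff (listField L) (-1) 1 = (L.map X).prod := by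
  induction L with
  | nil =>
    simp only [listField, identityField_ncoeff]
    refine ⟨fun n hn => ?_, by simp⟩
    rw [if_neg (by omega)]; rfl
  | cons i t ih =>
    obtain ⟨h1, h2⟩ := residualProduct_vacuum field_vacuum ih.1 (-(i : ℤ))
    refine ⟨h1, ?_⟩
    rw [listField, h2, ih.2, field_ncoeff, mode_neg, List.map_cons, List.prod_cons]

theorem isLocal_stateField (p q : Fock) : IsLocal (stateField p) (stateField q) := by
  rw [stateField_apply p, stateField_apply q]
  refine IsLocal.sum fun s _ => IsLocal.smul _ (IsLocal.symm ?_)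
  exact IsLocal.sum fun s _ => IsLocal.smul _ (isLocal_listField _ _)

theorem isLocal_field_stateField (q : Fock) : IsLocal field (stateField q) := by
  rw [stateField_apply q]
  exact (IsLocal.sum fun s _ => IsLocal.smul _ (isLocal_field_listField _).symm).symm

theorem covariant_stateField (p : Fock) : Covariant translation.toLinearMap (stateField p) := by
  rw [stateField_apply p]
  exact Covariant.sum fun s _ => Covariant.smul _ (covariant_listField _)

theorem stateField_nonneg (p : Fock) (n : ℤ) (hn : 0 ≤ n) : ncoeff (stateField p) n 1 = 0 := by
  rw [stateField_apply p, map_sum, Finset.sum_apply, LinearMap.sum_apply]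
  refine Finset.sum_eq_zero fun s _ => ?_
  rw [map_smul, Pi.smul_apply, LinearMap.smul_apply, (listField_vacuum _).1 n hn, smul_zero]

theorem stateField_neg_one (p : Fock) : ncoeff (stateField p) (-1) 1 = p := by
  rw [stateField_apply p, map_sum, Finset.sum_apply, LinearMap.sum_apply]
  conv_rhs => rw [p.as_sum]
  refine Finset.sum_congr rfl fun s _ => ?_
  rw [map_smul, Pi.smul_apply, LinearMap.smul_apply, (listField_vacuum _).2]
  rw [← Multiset.prod_coe, ← Multiset.map_coe, Multiset.sort_eq, monomial_eq, smul_eq_C_mul]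
  congr 1
  rw [Finsupp.toMultiset_map, Finsupp.prod_toMultiset,
    Finsupp.prod_mapDomain_index (fun _ => pow_zero _) (fun _ _ _ => pow_add _ _ _)]

end FreeBoson

open FreeBoson in
/-- The free bosonic vertex algebra: the vertex algebra structure on the Fock space of charge `0`
with vacuum vector `1` and `Y(x_1, z) = α(z)`. -/
def freeBosonicVertexAlgebra : VertexAlgebra Fock :=
  FormalField.vertexAlgebraOfLocal translation.toLinearMap 1 translation.map_one_eq_zero stateField
    stateField_nonneg stateField_neg_one covariant_stateField isLocal_stateField

theorem freeBosonicVertexAlgebra_vacuum : freeBosonicVertexAlgebra.vacuum = 1 := rfl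

open FreeBoson FormalField in
theorem freeBosonicVertexAlgebra_Y_X :
    freeBosonicVertexAlgebra.Y (MvPolynomial.X 1) = field := by
  change stateField _ = field
  rw [← sub_eq_zero]
  refine eq_zero_of_isLocal translation.map_one_eq_zero stateField_nonneg stateField_neg_one
    ((covariant_stateField _).sub covariant_field) ?_ fun a => ?_
  · intro n hn
    rw [map_sub, Pi.sub_apply, LinearMap.sub_apply]
    rcases eq_or_lt_of_le hn with rfl | hn
    · rw [stateField_neg_one, field_ncoeff, show (-1 : ℤ) = -((1 : ℕ+) : ℤ) from rfl, mode_neg,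
        mul_one, sub_self]
    · rw [stateField_nonneg _ _ (by omega), field_vacuum _ (by omega), sub_self]
  · exact (isLocal_stateField _ _).sub (isLocal_field_stateField a)

end

noncomputable section

/-! ### Termwise estimates for modes of residual products. -/

namespace FormalField

open VertexOperator

variable {M : Type*} [AddCommGroup M] [Module ℂ M]

/-! The proof counts contractions. In a product `p_(n) q`, each factor of `p` either multiplies by
some variable or is contracted with a variable of `q`, and each contraction lowers the total degree
by two. For `n ≥ 0` at least one contraction must occur, so degrees `k` and `l` give degree at most
`k + l - 2`. A single contraction of `x_i` with `x_j` contributes only for `n ≤ i + j - 1`. Hence,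
for polynomials in `x_1, …, x_N`, the product with `n = 2N - 1` is extremal: up to degree `k + l -
3` it sees only the contraction of `x_N` with itself, and equals `c_N · ∂p/∂x_N · ∂q/∂x_N` with
`c_N` a nonzero integer. This is `listField_apply_sub_mem` for monomials and
`stateField_apply_sub_mem` in general.

Let `h` be a Heisenberg vector of degree `k`, with top homogeneous component `p`, and let `x_N` be
the last variable of `p`. Then `h_(2N-1) h` is `c_N (∂p/∂x_N)²` modulo degree `2k - 3`. This square
is nonzero and homogeneous of degree `2k - 2`, while `h_(n) h` is `1` for `n = 1` and `0` for every
other `n ≥ 0`. So `2N - 1 = 1` and `2k - 2 = 0`, whence `N = k = 1` and, as `c_1 = 1`, `(∂p/∂x_1)² =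
1`. Thus `p = ±x_1` and `h - p` is constant.

Conversely, `Y(μ ± x_1, z) = μ I(z) ± α(z)` by linearity. The identity field commutes with
everything and the sign squares to one, so the commutation relations are those of `α`. Injectivity
of the state-field correspondence gives the last equivalences. -/

/-- Isolates a leading term: modulo a submodule that contains all the other terms, the sum defining
`half` is its term of index `a`. Below, `S` is always a step of the degree filtration. -/
theorem half_apply_sub_mem (A B : VertexOperator ℂ M) (k l m : ℤ) (v : M) (S : Submodule ℂ M)
    (a : ℕ) (h : ∀ i : ℕ, i ≠ a → (A[[k + m - i]]) ((B[[l + i]]) v) ∈ S) :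
    half A B k l m v -
      ((-1) ^ a * Ring.choose m a) • (A[[k + m - a]]) ((B[[l + a]]) v) ∈ S := by
  obtain ⟨N, hN⟩ := eventually_zero B v
  -- The range is long enough to contain every nonzero term and also the index `a`.
  rw [half_apply_sum A B k l m v (N + l.natAbs + a + 1) (by intro n hn; apply hN; omega),
    ← Finset.add_sum_erase _ _ (Finset.mem_range.2 (show a < N + l.natAbs + a + 1 by omega)),
    add_sub_cancel_left]
  exact sum_mem fun i hi => zsmul_mem (h i (Finset.ne_of_mem_erase hi)) _

theorem half_apply_mem (A B : VertexOperator ℂ M) (k l m : ℤ) (v : M) (S : Submodule ℂ M)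
    (h : ∀ i : ℕ, (A[[k + m - i]]) ((B[[l + i]]) v) ∈ S) : half A B k l m v ∈ S := by
  rw [← sub_add_cancel (half A B k l m v)
    (((-1) ^ 0 * Ring.choose m 0) • (A[[k + m - (0 : ℕ)]]) ((B[[l + (0 : ℕ)]]) v))]
  exact add_mem (half_apply_sub_mem A B k l m v S 0 fun i _ => h i) (zsmul_mem (h 0) _)

end FormalField

/-! ### The filtration of the Fock space by total degree. -/

namespace FreeBoson

open MvPolynomial FormalField VertexOperator

/-- The polynomials of total degree at most `d`, with `d` an integer. -/
def degreeFiltration (d : ℤ) : Submodule ℂ Fock :=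
  restrictSupport ℂ {s | (s.degree : ℤ) ≤ d}

theorem mem_degreeFiltration {d : ℤ} {p : Fock} :
    p ∈ degreeFiltration d ↔ ∀ s, p.coeff s ≠ 0 → (s.degree : ℤ) ≤ d := by
  rw [degreeFiltration, mem_restrictSupport_iff]
  exact ⟨fun h s hs => h (by simpa using hs), fun h s hs => h s (by simpa using hs)⟩

theorem degreeFiltration_mono {d e : ℤ} (h : d ≤ e) {p : Fock} (hp : p ∈ degreeFiltration d) :
    p ∈ degreeFiltration e :=
  mem_degreeFiltration.2 fun s hs => (mem_degreeFiltration.1 hp s hs).trans h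

theorem _root_.MvPolynomial.IsHomogeneous.mem_degreeFiltration {p : Fock} {d : ℕ}
    (hp : p.IsHomogeneous d) : p ∈ degreeFiltration d := by
  refine FreeBoson.mem_degreeFiltration.2 fun s hs => ?_
  rw [← hp hs, Finsupp.degree_eq_weight_one]
  rfl

theorem _root_.MvPolynomial.IsHomogeneous.eq_zero_of_mem_degreeFiltration {p : Fock} {d : ℕ}
    {e : ℤ} (hp : p.IsHomogeneous d) (he : p ∈ degreeFiltration e) (h : e < d) : p = 0 := by
  ext s
  rw [coeff_zero]
  by_contra hs
  have h1 := FreeBoson.mem_degreeFiltration.1 he s hs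
  have h2 : s.degree = d := by
    rw [← hp hs, Finsupp.degree_eq_weight_one]
    rfl
  omega

theorem mul_mem_degreeFiltration {d e : ℤ} {p q : Fock} (hp : p ∈ degreeFiltration d)
    (hq : q ∈ degreeFiltration e) : p * q ∈ degreeFiltration (d + e) := by
  classical
  refine mem_degreeFiltration.2 fun s hs => ?_
  rw [coeff_mul] at hs
  obtain ⟨x, hx, hne⟩ := Finset.exists_ne_zero_of_sum_ne_zero hs
  have h1 := mem_degreeFiltration.1 hp _ (left_ne_zero_of_mul hne)
  have h2 := mem_degreeFiltration.1 hq _ (right_ne_zero_of_mul hne)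
  rw [← (Finset.HasAntidiagonal.mem_antidiagonal.1 hx), map_add]
  push_cast
  omega

theorem X_mul_mem_degreeFiltration (i : ℕ+) {d : ℤ} {p : Fock} (hp : p ∈ degreeFiltration d) :
    X i * p ∈ degreeFiltration (d + 1) := by
  have := mul_mem_degreeFiltration (isHomogeneous_X ℂ i).mem_degreeFiltration hp
  rwa [Nat.cast_one, add_comm] at this

theorem pderiv_mem_degreeFiltration (i : ℕ+) {d : ℤ} {p : Fock} (hp : p ∈ degreeFiltration d) :
    pderiv i p ∈ degreeFiltration (d - 1) := by
  refine mem_degreeFiltration.2 fun s hs => ?_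
  rw [coeff_pderiv] at hs
  have := mem_degreeFiltration.1 hp _ (left_ne_zero_of_mul hs)
  rw [map_add, Finsupp.degree_single] at this
  push_cast at this
  omega

theorem mode_mem_degreeFiltration (n : ℤ) {d : ℤ} {p : Fock} (hp : p ∈ degreeFiltration d) :
    mode n p ∈ degreeFiltration (d + 1) := by
  induction n using mode_cases with
  | h0 => exact zero_mem _
  | hp i =>
    rw [mode_pos]
    exact Submodule.smul_mem _ _
      (degreeFiltration_mono (by omega) (pderiv_mem_degreeFiltration i hp))
  | hn i =>
    rw [mode_neg]
    exact X_mul_mem_degreeFiltration i hp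

/-- Annihilation modes lose a degree; the bound includes `n = 0` because `α_0` vanishes in charge
`0`. -/
theorem mode_natCast_mem_degreeFiltration (n : ℕ) {d : ℤ} {p : Fock}
    (hp : p ∈ degreeFiltration d) : mode n p ∈ degreeFiltration (d - 1) := by
  rcases Nat.eq_zero_or_pos n with rfl | hn
  · exact zero_mem _
  · lift n to ℕ+ using hn
    rw [mode_pos]
    exact Submodule.smul_mem _ _ (pderiv_mem_degreeFiltration n hp)

/-! ### Degree bounds for products with a monomial, by counting contractions. -/

/-- Separates the two roles of the factor `x_i`. In the first sum it acts last, through the creation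
operators `α_(-i-j)`; in the second it acts first on `q`, through `α_j` with `j ≥ 0`, which is a
contraction. Every estimate below is an induction on this splitting. -/
theorem listField_cons_apply (i : ℕ+) (t : List ℕ+) (n : ℤ) (q : Fock) :
    ncoeff (listField (i :: t)) n q = half field (listField t) 0 n (-i) q -
      ((-(i : ℤ)).negOnePow : ℤ) • half (listField t) field n 0 (-i) q := by
  rw [listField, residualProduct_ncoeff]
  rfl

/-- Each factor of the monomial raises the degree by at most one, whatever the mode. -/
theorem listField_apply_mem (L : List ℕ+) (n : ℤ) {l : ℤ} {q : Fock}
    (hq : q ∈ degreeFiltration l) :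
    ncoeff (listField L) n q ∈ degreeFiltration (L.length + l) := by
  induction L generalizing n l q with
  | nil =>
    rw [listField, identityField_ncoeff]
    split_ifs
    · exact degreeFiltration_mono (by simp) hq
    · exact zero_mem _
  | cons i t ih =>
    rw [listField_cons_apply]
    refine sub_mem (half_apply_mem _ _ _ _ _ _ _ fun j => ?_)
      (zsmul_mem (half_apply_mem _ _ _ _ _ _ _ fun j => ?_) _)
    · rw [field_ncoeff]
      refine degreeFiltration_mono ?_ (mode_mem_degreeFiltration _ (ih _ hq))
      simp only [List.length_cons]; push_cast; omega
    · rw [field_ncoeff]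
      refine degreeFiltration_mono ?_ (ih _ (mode_mem_degreeFiltration _ hq))
      simp only [List.length_cons]; push_cast; omega

/-- The part of `(x_i r)_(n) q` in which a mode `α_j` with `j ≥ 0` acts on `q`. -/
theorem half_listField_field_mem (t : List ℕ+) (n m : ℤ) {l : ℤ} {q : Fock}
    (hq : q ∈ degreeFiltration l) :
    half (listField t) field n 0 m q ∈ degreeFiltration (t.length + l - 1) := by
  refine half_apply_mem _ _ _ _ _ _ _ fun j => ?_
  rw [field_ncoeff, zero_add]
  exact degreeFiltration_mono (by omega)
    (listField_apply_mem t _ (mode_natCast_mem_degreeFiltration j hq))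

/-- A nonnegative mode forces a contraction. If `x_i` acts by creation, the rest of the monomial
still acts by a mode `n + j ≥ 0`, and induction applies; if it acts by annihilation, it is itself
contracted. -/
theorem listField_apply_mem_of_nonneg (L : List ℕ+) {n : ℤ} (hn : 0 ≤ n) {l : ℤ} {q : Fock}
    (hq : q ∈ degreeFiltration l) :
    ncoeff (listField L) n q ∈ degreeFiltration (L.length + l - 2) := by
  induction L generalizing n with
  | nil =>
    rw [listField, identityField_ncoeff, if_neg (by omega)]
    exact zero_mem _
  | cons i t ih =>
    rw [listField_cons_apply]
    refine sub_mem (half_apply_mem _ _ _ _ _ _ _ fun j => ?_) (zsmul_mem ?_ _)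
    · rw [field_ncoeff]
      refine degreeFiltration_mono ?_
        (mode_mem_degreeFiltration _ (ih (by omega : 0 ≤ n + j)))
      simp only [List.length_cons]; push_cast; omega
    · refine degreeFiltration_mono ?_ (half_listField_field_mem t n _ hq)
      simp only [List.length_cons]; push_cast; omega

/-- The only term without contraction is the one where all factors act by multiplication. In the
creation sum this is the term `j = 0`; for `j ≥ 1` the remaining factors act by the mode `j - 1 ≥ 0`
and so contract. -/
theorem listField_neg_one_apply_sub_mem (L : List ℕ+) {l : ℤ} {q : Fock}
    (hq : q ∈ degreeFiltration l) :
    ncoeff (listField L) (-1) q - (L.map X).prod * q ∈ degreeFiltration (L.length + l - 2) := by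
  induction L with
  | nil => simp [listField, identityField_ncoeff]
  | cons i t ih =>
    rw [listField_cons_apply, sub_right_comm]
    refine sub_mem ?_ (zsmul_mem ?_ _)
    · have h0 := half_apply_sub_mem field (listField t) 0 (-1) (-i) q
        (degreeFiltration ((i :: t).length + l - 2)) 0 fun j hj => by
          rw [field_ncoeff]
          refine degreeFiltration_mono ?_ (mode_mem_degreeFiltration _
            (listField_apply_mem_of_nonneg t (by omega : 0 ≤ -1 + (j : ℤ)) hq))
          simp only [List.length_cons]; push_cast; omega
      simp only [pow_zero, Ring.choose_zero_right, mul_one, one_smul, Nat.cast_zero, sub_zero,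
        add_zero, zero_add, field_ncoeff, mode_neg] at h0
      have h1 := X_mul_mem_degreeFiltration i ih
      rw [show (t.length : ℤ) + l - 2 + 1 = (i :: t).length + l - 2 by
        simp only [List.length_cons]; push_cast; ring, mul_sub] at h1
      convert add_mem h0 h1 using 1
      rw [List.map_cons, List.prod_cons]
      ring
    · refine degreeFiltration_mono ?_ (half_listField_field_mem t _ _ hq)
      simp only [List.length_cons]; push_cast; omega

/-! ### The extremal product for monomials in the first `N` variables. -/

theorem mode_apply_eq_zero {N : ℕ+} {q : Fock} (hq : ∀ j, N < j → pderiv j q = 0) {j : ℕ}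
    (hj : (N : ℕ) < j) : mode j q = 0 := by
  lift j to ℕ+ using by omega
  rw [mode_pos, hq j hj, smul_zero]

/-- One contraction is not enough here. If `x_i` is contracted through `α_j`, then `j ≤ N` or `q` is
killed, so the remaining factors act by the mode `n - i - j ≥ 0`, which forces a second contraction.
-/
theorem listField_apply_mem_of_le (L : List ℕ+) {N : ℕ+} (hL : ∀ i ∈ L, i ≤ N) {n : ℤ}
    (hn : 2 * (N : ℤ) ≤ n) {l : ℤ} {q : Fock} (hq : q ∈ degreeFiltration l)
    (hqN : ∀ j, N < j → pderiv j q = 0) :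
    ncoeff (listField L) n q ∈ degreeFiltration (L.length + l - 3) := by
  induction L generalizing n with
  | nil =>
    rw [listField, identityField_ncoeff, if_neg (by omega)]
    exact zero_mem _
  | cons i t ih =>
    have hi : (i : ℕ) ≤ N := hL i (by simp)
    rw [listField_cons_apply]
    refine sub_mem (half_apply_mem _ _ _ _ _ _ _ fun j => ?_)
      (zsmul_mem (half_apply_mem _ _ _ _ _ _ _ fun j => ?_) _)
    · rw [field_ncoeff]
      refine degreeFiltration_mono ?_ (mode_mem_degreeFiltration _
        (ih (fun i hi => hL i (by simp [hi])) (by omega : 2 * (N : ℤ) ≤ n + j)))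
      simp only [List.length_cons]; push_cast; omega
    · rw [field_ncoeff, zero_add]
      by_cases hj : (N : ℕ) < j
      · rw [mode_apply_eq_zero hqN hj, map_zero]
        exact zero_mem _
      · refine degreeFiltration_mono ?_ (listField_apply_mem_of_nonneg t
          (by omega : 0 ≤ n + -(i : ℤ) - j) (mode_natCast_mem_degreeFiltration j hq))
        simp only [List.length_cons]; push_cast; omega

/-- The coefficient of the leading contraction of `x_N` with itself. -/
def contractionCoeff (N : ℕ+) : ℤ :=
  -(((-(N : ℤ)).negOnePow : ℤ) * ((-1) ^ (N : ℕ) * Ring.choose (-(N : ℤ)) (N : ℕ)) * N)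

theorem contractionCoeff_one : contractionCoeff 1 = 1 := by
  simp [contractionCoeff]

theorem contractionCoeff_ne_zero (N : ℕ+) : contractionCoeff N ≠ 0 := by
  have h : Ring.choose (-(N : ℤ)) (N : ℕ) ≠ 0 := by
    rw [Ring.choose_neg]
    -- Upper negation turns the binomial coefficient into `± (2N - 1 choose N)`.
    have : (N : ℤ) + (N : ℕ) - 1 = ((2 * N - 1 : ℕ) : ℤ) := by
      have := N.pos
      omega
    rw [this, Ring.choose_natCast]
    have := Nat.choose_pos (show (N : ℕ) ≤ 2 * N - 1 by have := N.pos; omega)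
    simp only [smul_ne_zero_iff_ne, ne_eq]
    exact_mod_cast this.ne'
  unfold contractionCoeff
  simp [h]

/-- At `n = 2N - 1` the mode left after contracting `x_i` through `α_j` is `2N - 1 - i - j`. It is
nonnegative, forcing another contraction, unless `i = j = N`, when it is `-1` and the remaining
factors simply multiply. Adding these contributions over the factors `x_N` is the Leibniz rule for
`∂/∂x_N` on the monomial. -/
theorem listField_apply_sub_mem (L : List ℕ+) {N : ℕ+} (hL : ∀ i ∈ L, i ≤ N) {l : ℤ} {q : Fock}
    (hq : q ∈ degreeFiltration l) (hqN : ∀ j, N < j → pderiv j q = 0) :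
    ncoeff (listField L) (2 * N - 1) q -
      contractionCoeff N • (pderiv N (L.map X).prod * pderiv N q) ∈
        degreeFiltration (L.length + l - 3) := by
  have hN := N.pos
  induction L with
  | nil =>
    rw [listField, identityField_ncoeff, if_neg (by omega)]
    simp
  | cons i t ih =>
    have hi : (i : ℕ) ≤ N := hL i (by simp)
    have ht : ∀ i ∈ t, i ≤ N := fun i hi => hL i (by simp [hi])
    -- In the creation sum only `j = 0` matters: for `j ≥ 1` the other factors act by a mode at
    -- least `2N`.
    have h0 := half_apply_sub_mem field (listField t) 0 (2 * N - 1) (-i) q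
      (degreeFiltration ((i :: t).length + l - 3)) 0 fun j hj => by
        rw [field_ncoeff]
        refine degreeFiltration_mono ?_ (mode_mem_degreeFiltration _
          (listField_apply_mem_of_le t ht
            (by omega : 2 * (N : ℤ) ≤ 2 * (N : ℤ) - 1 + (j : ℤ)) hq hqN))
        simp only [List.length_cons]; push_cast; omega
    simp only [pow_zero, Ring.choose_zero_right, mul_one, one_smul, Nat.cast_zero, sub_zero,
      add_zero, zero_add, field_ncoeff, mode_neg] at h0
    have h1 := X_mul_mem_degreeFiltration i (ih ht)
    rw [show (t.length : ℤ) + l - 3 + 1 = (i :: t).length + l - 3 by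
      simp only [List.length_cons]; push_cast; ring, mul_sub] at h1
    -- Every term of the annihilation sum other than `i = j = N` is negligible.
    have hterm : ∀ j : ℕ, (i = N → j ≠ N) →
        ncoeff (listField t) (2 * N - 1 + -i - j) (ncoeff field (0 + j) q) ∈
          degreeFiltration ((i :: t).length + l - 3) := by
      intro j hij
      rw [field_ncoeff, zero_add]
      by_cases hj : (N : ℕ) < j
      · rw [mode_apply_eq_zero hqN hj, map_zero]
        exact zero_mem _
      · have hne : ¬ ((i : ℕ) = N ∧ j = N) := fun h => hij (PNat.eq h.1) h.2
        refine degreeFiltration_mono ?_ (listField_apply_mem_of_nonneg t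
          (by omega : 0 ≤ 2 * (N : ℤ) - 1 + -(i : ℤ) - j)
          (mode_natCast_mem_degreeFiltration j hq))
        simp only [List.length_cons]; push_cast; omega
    have hlead : X i * ncoeff (listField t) (2 * N - 1) q - contractionCoeff N •
        (X i * pderiv N (t.map X).prod * pderiv N q) ∈
          degreeFiltration ((i :: t).length + l - 3) := by
      convert h1 using 2
      rw [mul_smul_comm, mul_assoc]
    rw [listField_cons_apply, List.map_cons, List.prod_cons, pderiv_mul]
    by_cases hiN : i = N
    · subst hiN
      -- The surviving term has index `j = N`: the other factors act by the mode `-1`, hence by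
      -- multiplication to leading order, on `α_N q = N ∂q/∂x_N`. Its sign, binomial coefficient and
      -- factor `N` make up `contractionCoeff`.
      have h2 := half_apply_sub_mem (listField t) field (2 * i - 1) 0 (-i) q
        (degreeFiltration ((i :: t).length + l - 3)) i fun j hj => hterm j fun _ => hj
      have h3 := degreeFiltration_mono (e := (i :: t).length + l - 3)
        (by simp only [List.length_cons]; push_cast; omega)
        (listField_neg_one_apply_sub_mem t (mode_natCast_mem_degreeFiltration i hq))
      rw [mode_pos] at h3
      rw [show 2 * (i : ℤ) - 1 + -i - (i : ℕ) = -1 by ring, field_ncoeff, zero_add, mode_pos] at h2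
      convert sub_mem (add_mem h0 hlead) (zsmul_mem (add_mem h2
        (zsmul_mem h3 ((-1) ^ (i : ℕ) * Ring.choose (-(i : ℤ)) (i : ℕ))))
        ((-(i : ℤ)).negOnePow : ℤ)) using 1
      rw [pderiv_X_self, one_mul, contractionCoeff, mul_smul_comm,
        show ((i : ℕ) : ℂ) = ((i : ℤ) : ℂ) by simp, Int.cast_smul_eq_zsmul ℂ, add_mul]
      module
    · have h2 := half_apply_mem (listField t) field (2 * N - 1) 0 (-i) q
        (degreeFiltration ((i :: t).length + l - 3)) fun j => hterm j fun h => absurd h hiN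
      rw [pderiv_X_of_ne hiN, zero_mul, zero_add]
      convert sub_mem (add_mem h0 hlead) (zsmul_mem h2 ((-(i : ℤ)).negOnePow : ℤ)) using 1
      abel

/-! ### Extension of the estimates from monomials to polynomials. -/

theorem stateField_apply_mem_of_nonneg {k l n : ℤ} (hn : 0 ≤ n) {p q : Fock}
    (hp : p ∈ degreeFiltration k) (hq : q ∈ degreeFiltration l) :
    ncoeff (stateField p) n q ∈ degreeFiltration (k + l - 2) := by
  rw [stateField_apply, map_sum, Finset.sum_apply, LinearMap.sum_apply]
  refine sum_mem fun s hs => ?_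
  rw [map_smul, Pi.smul_apply, LinearMap.smul_apply]
  refine Submodule.smul_mem _ _
    (degreeFiltration_mono ?_ (listField_apply_mem_of_nonneg _ hn hq))
  have := mem_degreeFiltration.1 hp s (by simpa using hs)
  rw [Multiset.length_sort, Finsupp.card_toMultiset]
  change (s.degree : ℤ) + l - 2 ≤ _
  omega

theorem prod_map_sort_X (s : ℕ+ →₀ ℕ) :
    ((s.toMultiset.sort (· ≤ ·)).map X).prod = (monomial s 1 : Fock) := by
  rw [← Multiset.prod_coe, ← Multiset.map_coe, Multiset.sort_eq, monomial_eq,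
    Finsupp.toMultiset_map, Finsupp.prod_toMultiset,
    Finsupp.prod_mapDomain_index (fun _ => pow_zero _) (fun _ _ _ => pow_add _ _ _)]
  simp

/-- For polynomials `p`, `q` in `x_1, …, x_N` of degrees at most `k`, `l`, the leading part of
`p_(2N-1) q` is a multiple of `∂p/∂x_N · ∂q/∂x_N`. -/
theorem stateField_apply_sub_mem {k l : ℤ} {N : ℕ+} {p q : Fock}
    (hp : p ∈ degreeFiltration k) (hpN : ∀ j ∈ p.vars, j ≤ N)
    (hq : q ∈ degreeFiltration l) (hqN : ∀ j ∈ q.vars, j ≤ N) :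
    ncoeff (stateField p) (2 * N - 1) q - contractionCoeff N • (pderiv N p * pderiv N q) ∈
      degreeFiltration (k + l - 3) := by
  have e : pderiv N p = ∑ s ∈ p.support, p.coeff s • pderiv N (monomial s 1) := by
    conv_lhs => rw [p.as_sum, map_sum]
    refine Finset.sum_congr rfl fun s _ => ?_
    rw [← Derivation.map_smul, smul_monomial, smul_eq_mul, mul_one]
  rw [stateField_apply, map_sum, Finset.sum_apply, LinearMap.sum_apply, e, Finset.sum_mul,
    Finset.smul_sum, ← Finset.sum_sub_distrib]
  refine sum_mem fun s hs => ?_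
  rw [map_smul, Pi.smul_apply, LinearMap.smul_apply, smul_mul_assoc, smul_comm, ← smul_sub,
    ← prod_map_sort_X]
  refine Submodule.smul_mem _ _ (degreeFiltration_mono ?_ (listField_apply_sub_mem _ ?_ hq ?_))
  · have := mem_degreeFiltration.1 hp s (by simpa using hs)
    rw [Multiset.length_sort, Finsupp.card_toMultiset]
    change (s.degree : ℤ) + l - 3 ≤ _
    omega
  · intro i hi
    rw [Multiset.mem_sort, Finsupp.mem_toMultiset] at hi
    exact hpN i ((mem_vars_iff_mem_support i).2 ⟨s, hs, hi⟩)
  · intro j hj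
    exact pderiv_eq_zero_of_notMem_vars fun h => absurd (hqN j h) (not_le.2 hj)

/-! ### Top homogeneous components and their last variable. -/

theorem eq_zero_of_mem_degreeFiltration_of_neg {d : ℤ} (hd : d < 0) {p : Fock}
    (hp : p ∈ degreeFiltration d) : p = 0 := by
  ext s
  rw [coeff_zero]
  by_contra hs
  have := mem_degreeFiltration.1 hp s hs
  omega

theorem mem_degreeFiltration_totalDegree (p : Fock) : p ∈ degreeFiltration p.totalDegree := by
  refine mem_degreeFiltration.2 fun s hs => ?_
  have : s.degree ≤ p.totalDegree := le_totalDegree (mem_support_iff.2 hs)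
  exact_mod_cast this

theorem sub_homogeneousComponent_mem {p : Fock} {k : ℕ} (hp : p ∈ degreeFiltration k) :
    p - homogeneousComponent k p ∈ degreeFiltration (k - 1) := by
  refine mem_degreeFiltration.2 fun s hs => ?_
  rw [coeff_sub, coeff_homogeneousComponent] at hs
  split_ifs at hs with h
  · exact absurd (sub_self _) hs
  · rw [sub_zero] at hs
    have := mem_degreeFiltration.1 hp s hs
    omega

theorem homogeneousComponent_totalDegree_ne_zero {p : Fock} (hp : p ≠ 0) :
    homogeneousComponent p.totalDegree p ≠ 0 := by
  intro h
  have h1 := sub_homogeneousComponent_mem (mem_degreeFiltration_totalDegree p)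
  rw [h, sub_zero] at h1
  obtain ⟨s, hs, hd⟩ := Finset.exists_mem_eq_sup p.support (support_nonempty.2 hp)
    (fun s : ℕ+ →₀ ℕ => s.sum fun _ e => e)
  have h2 := mem_degreeFiltration.1 h1 s (mem_support_iff.1 hs)
  have h3 : p.totalDegree = s.degree := hd
  omega

theorem pderiv_ne_zero_of_mem_vars {p : Fock} {i : ℕ+} (hi : i ∈ p.vars) : pderiv i p ≠ 0 := by
  obtain ⟨s, hs, hsi⟩ := (mem_vars_iff_mem_support i).1 hi
  intro h
  -- Lowering the exponent of `x_i` in `s` by one gives a monomial whose coefficient in the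
  -- derivative is that of `s` in `p` times a positive integer, nonzero in characteristic zero.
  have := congrArg (coeff (s - Finsupp.single i 1)) h
  rw [coeff_pderiv, coeff_zero, Finsupp.sub_add_single_one_cancel (Finsupp.mem_support_iff.1 hsi),
    mul_eq_zero] at this
  rcases this with h' | h'
  · exact mem_support_iff.1 hs h'
  · exact Nat.cast_add_one_ne_zero _ h'

theorem eq_C_of_forall_pderiv_eq_zero {p : Fock} (h : ∀ i, pderiv i p = 0) :
    p = C (coeff 0 p) := by
  classical
  ext s
  rw [coeff_C]
  split_ifs with hs
  · rw [hs]
  · by_contra hne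
    obtain ⟨i, hi⟩ := Finsupp.support_nonempty_iff.2 (Ne.symm hs)
    exact pderiv_ne_zero_of_mem_vars
      ((mem_vars_iff_mem_support i).2 ⟨s, mem_support_iff.2 hne, hi⟩) (h i)

theorem vars_nonempty_of_isHomogeneous {p : Fock} {k : ℕ} (hp : p.IsHomogeneous k) (hk : k ≠ 0)
    (h0 : p ≠ 0) : p.vars.Nonempty := by
  rw [Finset.nonempty_iff_ne_empty]
  intro h
  have := eq_C_of_forall_pderiv_eq_zero (p := p)
    fun i => pderiv_eq_zero_of_notMem_vars (by simp [h])
  exact hk (hp.inj_right (this ▸ isHomogeneous_C _ _) h0)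

/-! ### The classification of Heisenberg vectors. -/

/-- The products `h_(n) h` with `n ≥ 0` of a Heisenberg vector `h`. -/
theorem _root_.VertexAlgebra.IsHeisenbergVector.apply_self {h : Fock}
    (hh : freeBosonicVertexAlgebra.IsHeisenbergVector h) {n : ℤ} (hn : 0 ≤ n) :
    ncoeff (stateField h) n h = if n = 1 then 1 else 0 := by
  -- The commutator of `h_(n)` and `h_(-1)` is evaluated on the vacuum, where `h_(-1) 1 = h` and
  -- `h_(n) 1 = 0`.
  have e := LinearMap.congr_fun (hh n (-1)) 1
  change ncoeff (stateField h) n (ncoeff (stateField h) (-1) 1) -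
    ncoeff (stateField h) (-1) (ncoeff (stateField h) n 1) = _ at e
  rw [stateField_neg_one, stateField_nonneg h n hn, map_zero, sub_zero] at e
  rw [e]
  by_cases h1 : n = 1
  · simp [h1]
  · rw [if_neg (by omega), if_neg h1]
    rfl

/-- The leading term of `h_(2N-1) h` for `h` of degree at most `k` such that `x_N` is the last
variable in the part of degree `k`. -/
theorem stateField_apply_self_sub_mem {h : Fock} {k : ℕ} (hk : h ∈ degreeFiltration k) {N : ℕ+}
    (hN : ∀ j ∈ (homogeneousComponent k h).vars, j ≤ N) :
    ncoeff (stateField h) (2 * N - 1) h - contractionCoeff N •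
      (pderiv N (homogeneousComponent k h) * pderiv N (homogeneousComponent k h)) ∈
        degreeFiltration (2 * k - 3) := by
  have hpos := N.pos
  have hn : (0 : ℤ) ≤ 2 * N - 1 := by omega
  set p := homogeneousComponent k h with hp
  have hp' : p ∈ degreeFiltration k :=
    (homogeneousComponent_isHomogeneous k h).mem_degreeFiltration
  have hlow : h - p ∈ degreeFiltration (k - 1) := sub_homogeneousComponent_mem hk
  -- Only the top component `p` needs its variables bounded by `x_N`. The products involving `h - p`
  -- lose two degrees to a contraction and one more to the lower factor, so they are negligible
  -- whatever variables occur in them.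
  have h1 := stateField_apply_sub_mem hp' hN hp' hN
  have h2 := stateField_apply_mem_of_nonneg hn hlow hk
  have h3 := stateField_apply_mem_of_nonneg hn hp' hlow
  rw [show (k : ℤ) + k - 3 = 2 * k - 3 by ring] at h1
  rw [show (k : ℤ) - 1 + k - 2 = 2 * k - 3 by ring] at h2
  rw [show (k : ℤ) + (k - 1) - 2 = 2 * k - 3 by ring] at h3
  convert add_mem h1 (add_mem h2 h3) using 1
  simp only [map_sub, Pi.sub_apply, LinearMap.sub_apply]
  abel

theorem eq_C_add_or_sub_of_isHeisenbergVector {h : Fock}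
    (hh : freeBosonicVertexAlgebra.IsHeisenbergVector h) :
    ∃ μ : ℂ, h = C μ + X 1 ∨ h = C μ - X 1 := by
  have hdeg := mem_degreeFiltration_totalDegree h
  -- A constant `h` would give `h_(1) h` of degree at most `-2`, that is `0` instead of `1`.
  have hk0 : h.totalDegree ≠ 0 := by
    intro h0
    rw [h0] at hdeg
    have h1 := eq_zero_of_mem_degreeFiltration_of_neg (by norm_num)
      (stateField_apply_mem_of_nonneg zero_le_one hdeg hdeg)
    rw [hh.apply_self zero_le_one, if_pos rfl] at h1
    exact one_ne_zero h1
  have hne : h ≠ 0 := by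
    rintro rfl
    simp at hk0
  set k := h.totalDegree
  have hp0 := homogeneousComponent_totalDegree_ne_zero hne
  have hhom := homogeneousComponent_isHomogeneous k h
  have hlow := sub_homogeneousComponent_mem hdeg
  have hvars := vars_nonempty_of_isHomogeneous hhom hk0 hp0
  obtain ⟨N, hNmem, hNmax⟩ : ∃ N ∈ (homogeneousComponent k h).vars,
      ∀ j ∈ (homogeneousComponent k h).vars, j ≤ N :=
    ⟨_, Finset.max'_mem _ hvars, fun j hj => Finset.le_max' _ j hj⟩
  have hNpos := N.pos
  have hlead := stateField_apply_self_sub_mem hdeg hNmax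
  rw [hh.apply_self (by omega)] at hlead
  set p := homogeneousComponent k h
  have hd : pderiv N p ≠ 0 := pderiv_ne_zero_of_mem_vars hNmem
  have hsq : contractionCoeff N • (pderiv N p * pderiv N p) ≠ 0 :=
    smul_ne_zero (contractionCoeff_ne_zero N) (mul_ne_zero hd hd)
  have hsqhom : (contractionCoeff N • (pderiv N p * pderiv N p)).IsHomogeneous
      (k - 1 + (k - 1)) :=
    zsmul_mem (K := homogeneousSubmodule ℕ+ ℂ (k - 1 + (k - 1))) (hhom.pderiv.mul hhom.pderiv) _
  have hone : (1 : Fock) ∈ degreeFiltration 0 := (isHomogeneous_one ℕ+ ℂ).mem_degreeFiltration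
  -- The leading term is nonzero and homogeneous of degree `2k - 2`, so it cannot be absorbed in
  -- lower degree.
  have hcontr : contractionCoeff N • (pderiv N p * pderiv N p) ∉ degreeFiltration (2 * k - 3) :=
    fun hmem => hsq (hsqhom.eq_zero_of_mem_degreeFiltration hmem (by omega))
  -- For `N ≠ 1` the product `h_(2N-1) h` vanishes, so the leading term would be negligible.
  have hN1 : N = 1 := by
    by_contra hN1
    have : (N : ℕ) ≠ 1 := fun e => hN1 (PNat.eq e)
    rw [if_neg (by omega), zero_sub, neg_mem_iff] at hlead
    exact hcontr hlead
  subst hN1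
  rw [if_pos (by norm_num)] at hlead
  -- Now `h_(1) h = 1`; for `k ≥ 2` this constant has degree at most `2k - 3`, so the leading term
  -- would again be negligible.
  have hk1 : k = 1 := by
    by_contra hk1
    refine hcontr ?_
    have := sub_mem (degreeFiltration_mono (by omega : (0 : ℤ) ≤ 2 * k - 3) hone) hlead
    rwa [sub_sub_cancel] at this
  rw [hk1] at hlead hlow
  -- For `k = 1` the error has degree at most `-1`, so the congruence is the exact equation `1 =
  -- (∂p/∂x_1)²`, whose only solutions in a domain are `±1`.
  have hpp := eq_zero_of_mem_degreeFiltration_of_neg (by norm_num) hlead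
  rw [contractionCoeff_one, one_smul, sub_eq_zero, eq_comm, mul_self_eq_one_iff] at hpp
  -- Since `h - p` has degree at most `0`, its derivatives vanish. It then remains to see that all
  -- partial derivatives of `h ∓ x_1` are zero.
  have hpd : ∀ j, pderiv j h = pderiv j p := fun j => by
    have := eq_zero_of_mem_degreeFiltration_of_neg (by norm_num)
      (pderiv_mem_degreeFiltration j hlow)
    rwa [map_sub, sub_eq_zero] at this
  have hpd' : ∀ j, j ≠ 1 → pderiv j h = 0 := fun j hj => by
    rw [hpd, pderiv_eq_zero_of_notMem_vars]
    exact fun hmem => hj (le_antisymm (hNmax j hmem) (one_le))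
  rcases hpp with hpp | hpp
  · refine ⟨_, Or.inl (sub_eq_iff_eq_add.1 (eq_C_of_forall_pderiv_eq_zero fun j => ?_))⟩
    by_cases hj : j = 1
    · rw [hj, map_sub, hpd, hpp, pderiv_X_self, sub_self]
    · rw [map_sub, hpd' j hj, pderiv_X_of_ne (Ne.symm hj), sub_self]
  · refine ⟨_, Or.inr (eq_sub_iff_add_eq.2 (eq_C_of_forall_pderiv_eq_zero fun j => ?_))⟩
    by_cases hj : j = 1
    · rw [hj, map_add, hpd, hpp, pderiv_X_self, neg_add_cancel]
    · rw [map_add, hpd' j hj, pderiv_X_of_ne (Ne.symm hj), add_zero]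

/-! ### The fields of `μ ± x_1`. -/

theorem stateField_one : stateField 1 = identityField Fock := by
  have : (1 : Fock) = basisMonomials ℕ+ ℂ 0 := by simp
  rw [this, stateField, Module.Basis.constr_basis]
  simp [listField]

theorem stateField_C (μ : ℂ) : stateField (C μ) = μ • identityField Fock := by
  rw [← mul_one (C μ), ← smul_eq_C_mul, map_smul, stateField_one]

theorem stateField_X_one : stateField (X 1) = field := freeBosonicVertexAlgebra_Y_X

/-- A vector is recovered from its field by applying the mode `-1` to the vacuum. -/
theorem stateField_injective : Function.Injective stateField := fun p q h => by
  rw [← stateField_neg_one p, h, stateField_neg_one]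

/-- Adding a multiple of the identity field and rescaling by a square root of `1` preserve
Heisenberg fields. -/
theorem _root_.IsHeisenbergField.smul_identityField_add_smul {M : Type*} [AddCommGroup M]
    [Module ℂ M] {A : VertexOperator ℂ M} (hA : IsHeisenbergField A) (μ : ℂ) {ε : ℂ}
    (hε : ε * ε = 1) : IsHeisenbergField (μ • identityField M + ε • A) := by
  intro m n
  have key : ∀ n, ncoeff (μ • identityField M + ε • A) n =
      (if n = -1 then μ else 0) • (1 : Module.End ℂ M) + ε • ncoeff A n := by
    intro n
    rw [map_add, map_smul, map_smul, Pi.add_apply, Pi.smul_apply, Pi.smul_apply,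
      identityField_ncoeff]
    split_ifs <;> simp
  -- The multiples of the identity drop out of the commutator, and the part quadratic in `A` is
  -- multiplied by `ε² = 1`.
  have e : (ε • ncoeff A m) * (ε • ncoeff A n) - (ε • ncoeff A n) * (ε • ncoeff A m) =
      ncoeff A m * ncoeff A n - ncoeff A n * ncoeff A m := by
    simp only [smul_mul_smul_comm, hε, one_smul]
  rw [← hA m n, ← e, key, key]
  simp only [mul_add, add_mul, smul_mul_assoc, mul_smul_comm, one_mul, mul_one]
  module

end FreeBoson

end

theorem theorem3p3 (h : Fock) :
    (freeBosonicVertexAlgebra.IsHeisenbergVector h ↔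
      ∃ μ : ℂ, h = MvPolynomial.C μ + MvPolynomial.X 1 ∨ h = MvPolynomial.C μ - MvPolynomial.X 1) ∧
    ∀ μ : ℂ,
      (h = MvPolynomial.C μ + MvPolynomial.X 1 ↔
        freeBosonicVertexAlgebra.Y h = μ • FormalField.identityField Fock + FreeBoson.field) ∧
      (h = MvPolynomial.C μ - MvPolynomial.X 1 ↔
        freeBosonicVertexAlgebra.Y h = μ • FormalField.identityField Fock - FreeBoson.field) := by
  have hY : freeBosonicVertexAlgebra.Y = FreeBoson.stateField := rfl
  have hadd : ∀ μ : ℂ, FreeBoson.stateField (MvPolynomial.C μ + MvPolynomial.X 1) =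
      μ • FormalField.identityField Fock + FreeBoson.field := fun μ => by
    rw [map_add, FreeBoson.stateField_C, FreeBoson.stateField_X_one]
  have hsub : ∀ μ : ℂ, FreeBoson.stateField (MvPolynomial.C μ - MvPolynomial.X 1) =
      μ • FormalField.identityField Fock - FreeBoson.field := fun μ => by
    rw [map_sub, FreeBoson.stateField_C, FreeBoson.stateField_X_one]
  refine ⟨⟨FreeBoson.eq_C_add_or_sub_of_isHeisenbergVector, ?_⟩, fun μ => ⟨?_, ?_⟩⟩
  · rintro ⟨μ, rfl | rfl⟩
    · rw [VertexAlgebra.IsHeisenbergVector, hY, hadd, ← one_smul ℂ FreeBoson.field]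
      exact FreeBoson.isHeisenbergField_field.smul_identityField_add_smul μ (by norm_num)
    · rw [VertexAlgebra.IsHeisenbergVector, hY, hsub, sub_eq_add_neg,
        ← neg_one_smul ℂ FreeBoson.field]
      exact FreeBoson.isHeisenbergField_field.smul_identityField_add_smul μ (by norm_num)
  · rw [hY, ← hadd, FreeBoson.stateField_injective.eq_iff]
  · rw [hY, ← hsub, FreeBoson.stateField_injective.eq_iff]
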